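/- **Network.** $\Pi$ is a set of $n$ nodes, joined by the links of a connected graph $G$. Nodes know their neighbors in $G$ and the names of all nodes. They fail only by crashing, permanently; a node is *live* until it crashes and *correct* if it never crashes. $G(t)$ is $G$ without the nodes crashed at time $t$. Node $p$ has an integer-valued clock ticking at a constant rate (clocks need not be synchronized and their rates may differ) and an integer period $T_p\ge 1$; its clock initially shows at most $T_p$ (for example $0$). Events take no time, there are finitely many of them in bounded time, and an action whose precondition holds at a live node is performed before the node's clock moves on. **Channels.** A link consists of two one-way channels, which neither create nor duplicate messages but may lose, delay and reorder them. Each is an *ADD channel*: in every execution there are $d$, $r$ (unknown to the nodes) and a set of *privileged* messages such that privileged messages are delivered within time $d$ (unless the receiver crashes), and at most $r$ messages in a row are not privileged. **Algorithm, code for $p$.** Below, "neighbor" means neighbor of $p$ in $G$ (so $p$ is a non-neighbor of itself); paths are sequences of nodes. Variables and initial values: $last\_contact[q]=0$ and $timeout[q]=T_p$ for neighbors $q$; $suspect\_local[q]=suspect[q]=\mathrm{false}$ for all $q\in\Pi$; $paths[p]=\{p\}$, $paths[q]=\{q\cdot p\}$ for neighbors $q$, $paths[r]=\emptyset$ for other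 $r$. Node $p$ *suspects* $q$ when $suspect[q]$ is true. - *Derive*: put $suspect:=suspect\_local$; then for every non-neighbor $r$ such that each path in $paths[r]$ contains some $u\ne r$ with $suspect\_local[u]$ true, put $suspect[r]:=\mathrm{true}$. - *Heartbeat*, when the clock shows a multiple $kT_p$, $k\in\mathbb N$: send $\langle suspect\_local, paths, p\rangle$ to every neighbor. - *Timer expiry* for a neighbor $q$, when $timeout[q]=clock-last\_contact[q]$: put $suspect\_local[q]:=\mathrm{true}$ and derive. - *Receipt* of $\langle suspect\_rcv, path\_sets, q\rangle$: if $suspect\_local[q]$ is true, put $timeout[q]:=2(clock-last\_contact[q])$ and $suspect\_local[q]:=\mathrm{false}$. Put $last\_contact[q]:=clock$. Then, for all non-neighbors $r$ one after the other, in any order: let $h'$ be the length of a shortest path in $path\_sets[r]$ that contains neither $p$ nor a node $u\neq r$ with $suspect\_rcv[u]$ true, and $h$ the length of a shortest path in $paths[r]$ that contains no $u\ne r$ with $suspect\_local[u]$ true ($\infty$ if there is none); if $h'<h$, put $suspect\_local[r]:=suspect\_rcv[r]$; and add to $paths[r]$ the path $\pi\cdot p$ for every $\pi\in path\_sets[r]$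 not containing $p$. Finally derive. **Theorem.** The algorithm implements an eventually perfect failure detector ($\Diamond P$) for partitionable networks of ADD channels, with messages of bounded size: 1. In every execution there is a time $t_f$ such that for every $t>t_f$ and every correct node $p$, at time $t$: $p$ suspects every node $q$ that is not connected to $p$ in $G(t)$, that is, crashed or in another component (*strong completeness*), and $p$ suspects no node $q$ that is connected to $p$ in $G(t)$ (*eventual strong accuracy*). 2. Every message sent has size $O((n+1)!)$ bits: there is an absolute constant $C$ such that, in every execution on every such network, every heartbeat has at most $C\,(n+1)!$ bits. Here a message is encoded by the $n$ bits of $suspect\_local$, the list of the paths in each $paths[r]$, and the name of the sender, where a node name takes $\lceil\log_2 n\rceil$ bits and the lists are delimited by one extra bit per entry and one at the end. -/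

import Mathlib

open Filter

/-! ### Messages and their binary encoding -/

/-- A heartbeat message: a copy of the sender's local suspect list, a copy of its array of path
sets, and the sender's name.  Nodes are named by the elements of `Fin n`, and a path
`r · q₁ ⋯ qₖ` is the list `[r, q₁, …, qₖ]`. -/
@[ext] structure Message (n : ℕ) where
  suspects : Fin n → Bool
  paths : Fin n → Finset (List (Fin n))
  sender : Fin n

/-- A node name, written in binary with `⌈log₂ n⌉` bits. -/
def encodeId {n : ℕ} (v : Fin n) : List Bool :=
  List.ofFn fun i : Fin (Nat.clog 2 n) => v.val.testBit i

/-- A path: every node name is preceded by a bit `true`, and the list is closed by a `false`. -/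
def encodePath {n : ℕ} (π : List (Fin n)) : List Bool :=
  (π.flatMap fun v => true :: encodeId v) ++ [false]

/-- A list of paths: every path is preceded by a bit `true`, the list is closed by a `false`. -/
def encodePathList {n : ℕ} (L : List (List (Fin n))) : List Bool :=
  (L.flatMap fun π => true :: encodePath π) ++ [false]

/-- The bit string transmitted for a message: `n` bits for the suspect list, then the path sets of
all nodes in turn (each one listed in a fixed order), then the name of the sender. -/
noncomputable def Message.encode {n : ℕ} (m : Message n) : List Bool :=
  List.ofFn m.suspects ++
    (((List.finRange n).flatMap fun r => encodePathList (m.paths r).toList) ++ encodeId m.sender)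

/-- The size of a message in bits. -/
noncomputable def Message.bits {n : ℕ} (m : Message n) : ℕ := m.encode.length

theorem encodeId_append_inj {n : ℕ} {v w : Fin n} {x y : List Bool}
    (h : encodeId v ++ x = encodeId w ++ y) : v = w ∧ x = y := by
  obtain ⟨h1, h2⟩ := List.append_inj h (by simp [encodeId])
  refine ⟨?_, h2⟩
  have h3 := List.ofFn_injective h1
  apply Fin.ext
  apply Nat.eq_of_testBit_eq
  intro i
  by_cases hi : i < Nat.clog 2 n
  · exact congrFun h3 ⟨i, hi⟩
  · have hp : n ≤ 2 ^ i :=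
      (Nat.le_pow_clog (by norm_num) n).trans (Nat.pow_le_pow_right (by norm_num) (by omega))
    rw [Nat.testBit_lt_two_pow (lt_of_lt_of_le v.isLt hp),
      Nat.testBit_lt_two_pow (lt_of_lt_of_le w.isLt hp)]

theorem encodePath_append_inj {n : ℕ} {π ρ : List (Fin n)} {x y : List Bool}
    (h : encodePath π ++ x = encodePath ρ ++ y) : π = ρ ∧ x = y := by
  induction π generalizing ρ with
  | nil => cases ρ <;> simp_all [encodePath]
  | cons v π ih =>
    cases ρ with
    | nil => simp [encodePath] at h
    | cons w ρ =>
      have h' : encodeId v ++ (encodePath π ++ x) = encodeId w ++ (encodePath ρ ++ y) := by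
        simpa [encodePath] using h
      obtain ⟨h1, h2⟩ := encodeId_append_inj h'
      obtain ⟨h3, h4⟩ := ih h2
      exact ⟨by rw [h1, h3], h4⟩

theorem encodePathList_append_inj {n : ℕ} {L M : List (List (Fin n))} {x y : List Bool}
    (h : encodePathList L ++ x = encodePathList M ++ y) : L = M ∧ x = y := by
  induction L generalizing M with
  | nil => cases M <;> simp_all [encodePathList]
  | cons π L ih =>
    cases M with
    | nil => simp [encodePathList] at h
    | cons ρ M =>
      have h' : encodePath π ++ (encodePathList L ++ x) =
          encodePath ρ ++ (encodePathList M ++ y) := by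
        simpa [encodePathList] using h
      obtain ⟨h1, h2⟩ := encodePath_append_inj h'
      obtain ⟨h3, h4⟩ := ih h2
      exact ⟨by rw [h1, h3], h4⟩

/-- A message can be recovered from its encoding. -/
theorem Message.encode_injective {n : ℕ} : Function.Injective (Message.encode (n := n)) := by
  have key : ∀ (l : List (Fin n)) (f g : Fin n → Finset (List (Fin n))) (x y : List Bool),
      (l.flatMap fun r => encodePathList (f r).toList) ++ x =
        (l.flatMap fun r => encodePathList (g r).toList) ++ y →
      (∀ r ∈ l, f r = g r) ∧ x = y := by
    intro l f g x y
    induction l with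
    | nil => simp
    | cons a l ih =>
      intro h
      simp only [List.flatMap_cons, List.append_assoc] at h
      obtain ⟨h1, h2⟩ := encodePathList_append_inj h
      obtain ⟨h3, h4⟩ := ih h2
      have h5 : f a = g a := by
        ext z
        rw [← Finset.mem_toList, h1, Finset.mem_toList]
      exact ⟨by simpa [h5] using h3, h4⟩
  intro a b h
  unfold Message.encode at h
  obtain ⟨h1, h2⟩ := List.append_inj h (by simp)
  obtain ⟨h3, h4⟩ := key _ _ _ _ _ h2
  have h5 := encodeId_append_inj (x := []) (y := []) (by simpa using h4)
  exact Message.ext (List.ofFn_injective h1) (funext fun r => h3 r (List.mem_finRange r)) h5.1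

/-! ### The algorithm, as run by a node `p` of the initial graph `G` -/

/-- The variables of a node.  The arrays `lastContact` and `timeout` are only used at the
neighbours of the node. -/
structure NodeState (n : ℕ) where
  lastContact : Fin n → ℤ
  suspectLocal : Fin n → Bool
  paths : Fin n → Finset (List (Fin n))
  suspect : Fin n → Bool
  timeout : Fin n → ℤ

/-- The set of nodes suspected by a node in a given state. -/
def NodeState.suspected {n : ℕ} (s : NodeState n) : Set (Fin n) := {q | s.suspect q = true}

/-- The heartbeat message that a node `p` in state `s` sends to all its neighbours. -/
def NodeState.heartbeat {n : ℕ} (s : NodeState n) (p : Fin n) : Message n :=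
  ⟨s.suspectLocal, s.paths, p⟩

open Classical in
/-- The initial state of node `p`, whose heartbeat period is `T`. -/
noncomputable def initialState {n : ℕ} (G : SimpleGraph (Fin n)) (T : ℕ) (p : Fin n) :
    NodeState n where
  lastContact := fun _ => 0
  suspectLocal := fun _ => false
  paths := fun r => if r = p then {[p]} else if G.Adj p r then {[r, p]} else ∅
  suspect := fun _ => false
  timeout := fun _ => T

/-- The number of hops of a path. -/
def hops {n : ℕ} (π : List (Fin n)) : ℕ∞ := ((π.length - 1 : ℕ) : ℕ∞)

/-- The length of a shortest path in the received set `m.paths r` that contains neither `p` nor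
a node `u ≠ r` suspected in the message (`⊤` if there is none). -/
noncomputable def hopFromMsg {n : ℕ} (p : Fin n) (m : Message n) (r : Fin n) : ℕ∞ :=
  ((m.paths r).filter fun π => p ∉ π ∧ ∀ u ∈ π, u ≠ r → m.suspects u = false).inf hops

/-- The length of a shortest path in the own set `s.paths r` that contains no locally suspected
node `u ≠ r` (`⊤` if there is none). -/
noncomputable def hop {n : ℕ} (s : NodeState n) (r : Fin n) : ℕ∞ :=
  ((s.paths r).filter fun π => ∀ u ∈ π, u ≠ r → s.suspectLocal u = false).inf hops

/-- First part of the effect of receiving a message from the neighbour `q` when the local clock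
reads `c`: repair a wrong suspicion of `q`, and record the contact. -/
def contact {n : ℕ} (c : ℤ) (q : Fin n) (s : NodeState n) : NodeState n :=
  { s with
    timeout := if s.suspectLocal q = true
      then Function.update s.timeout q (2 * (c - s.lastContact q)) else s.timeout
    suspectLocal := Function.update s.suspectLocal q false
    lastContact := Function.update s.lastContact q c }

/-- The body, for the node `r`, of the loop over all non-neighbours: adopt the information about
`r` if the sender is nearer to `r`, and add the new paths from `r`. -/
noncomputable def learn {n : ℕ} (p : Fin n) (m : Message n) (s : NodeState n) (r : Fin n) :
    NodeState n :=
  { s with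
    suspectLocal := if hopFromMsg p m r < hop s r
      then Function.update s.suspectLocal r (m.suspects r) else s.suspectLocal
    paths := Function.update s.paths r
      (s.paths r ∪ ((m.paths r).filter fun π => p ∉ π).image fun π => π ++ [p]) }

open Classical in
/-- The computation of the array `suspect` from `suspectLocal` and `paths`. -/
noncomputable def derive {n : ℕ} (G : SimpleGraph (Fin n)) (p : Fin n) (s : NodeState n) :
    NodeState n :=
  { s with
    suspect := fun r =>
      if ¬ G.Adj p r ∧ ∀ π ∈ s.paths r, ∃ u ∈ π, u ≠ r ∧ s.suspectLocal u = true
      then true else s.suspectLocal r }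

/-- The effect at `p` of receiving the message `m` when the local clock reads `c`.  The list
`order` is the order in which the loop runs through the non-neighbours of `p`. -/
noncomputable def receive {n : ℕ} (G : SimpleGraph (Fin n)) (p : Fin n) (c : ℤ) (m : Message n)
    (order : List (Fin n)) (s : NodeState n) : NodeState n :=
  derive G p (order.foldl (learn p m) (contact c m.sender s))

/-- The effect at `p` of the expiry of the timer for the neighbour `q`: suspect `q` locally, and
bring the array `suspect` up to date. -/
noncomputable def expire {n : ℕ} (G : SimpleGraph (Fin n)) (p q : Fin n) (s : NodeState n) :
    NodeState n :=
  derive G p { s with suspectLocal := Function.update s.suspectLocal q true }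

/-! ### Executions -/

/-- A local clock, which ticks at a constant rate. -/
structure LocalClock where
  rate : ℝ
  offset : ℝ
  rate_pos : 0 < rate

/-- The integer shown by a local clock at real time `t`. -/
noncomputable def LocalClock.reading (c : LocalClock) (t : ℝ) : ℤ := ⌊c.offset + c.rate * t⌋

/-- The events of an execution.  `recv p q m` is the receipt by `p` of the message that was sent
to it by `q` in the `m`-th event of the execution. -/
inductive Event (n : ℕ) where
  | idle : Event n
  | crash (p : Fin n) : Event n
  | heartbeat (p : Fin n) : Event n
  | timerExpiry (p q : Fin n) : Event n
  | recv (p q : Fin n) (m : ℕ) : Event n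

/-- The data of a timed sequence of events.  At time `time 0` the nodes are in the states
`state 0`; the event `event i` takes place at time `time (i + 1)` and leads from the states
`state i` to the states `state (i + 1)`. -/
structure Trace (n : ℕ) where
  time : ℕ → ℝ
  event : ℕ → Event n
  state : ℕ → Fin n → NodeState n

namespace Trace

variable {n : ℕ}

/-- Node `p` has not crashed in the first `i` events. -/
def Live (E : Trace n) (i : ℕ) (p : Fin n) : Prop := ∀ j < i, E.event j ≠ Event.crash p

/-- Node `p` never crashes. -/
def Correct (E : Trace n) (p : Fin n) : Prop := ∀ j, E.event j ≠ Event.crash p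

/-- The set of nodes that are crashed at time `t`. -/
def crashedAt (E : Trace n) (t : ℝ) : Set (Fin n) :=
  {p | ∃ i, E.event i = Event.crash p ∧ E.time (i + 1) ≤ t}

/-- The network graph at time `t`: the initial graph without the nodes crashed at time `t`. -/
def networkGraph (E : Trace n) (G : SimpleGraph (Fin n)) (t : ℝ) : G.Subgraph :=
  (⊤ : G.Subgraph).deleteVerts (E.crashedAt t)

/-- The `i`-th event of the trace is a correct step of the algorithm. -/
def IsStep (E : Trace n) (G : SimpleGraph (Fin n)) (T : Fin n → ℕ) (clock : Fin n → LocalClock)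
    (i : ℕ) : Prop :=
  match E.event i with
  | Event.idle => E.state (i + 1) = E.state i
  | Event.crash p => E.Live i p ∧ E.state (i + 1) = E.state i
  | Event.heartbeat p =>
      E.Live i p ∧ (∃ k : ℕ, (clock p).reading (E.time (i + 1)) = k * T p) ∧
        E.state (i + 1) = E.state i
  | Event.timerExpiry p q =>
      E.Live i p ∧ G.Adj p q ∧
        (E.state i p).timeout q =
          (clock p).reading (E.time (i + 1)) - (E.state i p).lastContact q ∧
        E.state (i + 1) = Function.update (E.state i) p (expire G p q (E.state i p))
  | Event.recv p q m =>
      E.Live i p ∧ G.Adj p q ∧ m < i ∧ E.event m = Event.heartbeat q ∧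
        ∃ order : List (Fin n), order.Nodup ∧ (∀ r, r ∈ order ↔ ¬ G.Adj p r) ∧
          E.state (i + 1) = Function.update (E.state i) p
            (receive G p ((clock p).reading (E.time (i + 1))) ((E.state m q).heartbeat q) order
              (E.state i p))

/-- The trace is an execution of the algorithm with heartbeat periods `T` over channels that
neither create nor duplicate messages, but may lose, delay and reorder them.

The last two clauses say that the two actions of a node are really performed: if, when the local
clock of `p` leaves the value `c`, node `p` is live and the precondition of the action holds, then
`p` has performed the action while its clock was showing `c`. -/
structure IsExecution (E : Trace n) (G : SimpleGraph (Fin n)) (T : Fin n → ℕ)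
    (clock : Fin n → LocalClock) : Prop where
  time_zero : E.time 0 = 0
  time_mono : Monotone E.time
  time_unbounded : Tendsto E.time atTop atTop
  state_zero : ∀ p, E.state 0 p = initialState G (T p) p
  step : ∀ i, E.IsStep G T clock i
  no_duplication : ∀ i j p q m,
    E.event i = Event.recv p q m → E.event j = Event.recv p q m → i = j
  heartbeat_performed : ∀ (i : ℕ) (p : Fin n) (k : ℕ), E.Live i p →
    (clock p).reading (E.time i) ≤ k * T p → k * T p < (clock p).reading (E.time (i + 1)) →
    ∃ j < i, E.event j = Event.heartbeat p ∧ (clock p).reading (E.time (j + 1)) = k * T p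
  timer_performed : ∀ (i : ℕ) (p q : Fin n) (c : ℤ), E.Live i p → G.Adj p q →
    (clock p).reading (E.time i) ≤ c → c < (clock p).reading (E.time (i + 1)) →
    (E.state i p).timeout q = c - (E.state i p).lastContact q →
    ∃ j < i, E.event j = Event.timerExpiry p q ∧ (clock p).reading (E.time (j + 1)) = c

/-- The channel from `q` to `p` is an ADD channel.  The messages sent on it are those of the
heartbeat events of `q`; `priv` is the set of (indices of) privileged messages, which are delivered
within time `d` unless the receiver crashes, and at most `r` messages are sent without a privileged
one among them. -/
def IsADDChannel (E : Trace n) (q p : Fin n) : Prop :=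
  ∃ (d : ℝ) (r : ℕ) (priv : Set ℕ),
    (∀ m ∈ priv, E.event m = Event.heartbeat q) ∧
    (∀ m ∈ priv, ∃ i, (E.event i = Event.recv p q m ∨ E.event i = Event.crash p) ∧
      E.time (i + 1) ≤ E.time (m + 1) + d) ∧
    ∀ a b : ℕ, (∀ m, a ≤ m → m < b → m ∉ priv) →
      {m | a ≤ m ∧ m < b ∧ E.event m = Event.heartbeat q}.ncard ≤ r

/-- The states `state i` are in force at time `t`. -/
def InForce (E : Trace n) (i : ℕ) (t : ℝ) : Prop := E.time i ≤ t ∧ t ≤ E.time (i + 1)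

end Trace

/-- Two nodes are connected in a subgraph: both belong to it, and a path of it joins them. -/
def ConnectedIn {V : Type*} {G : SimpleGraph V} (H : G.Subgraph) (p q : V) : Prop :=
  ∃ (hp : p ∈ H.verts) (hq : q ∈ H.verts), H.coe.Reachable ⟨p, hp⟩ ⟨q, hq⟩

/-- The suspicions in the trace are those of an eventually perfect failure detector for the
partitionable network `G`: from some time on, every correct node suspects the nodes that are
disconnected from it (strong completeness) and does not suspect the nodes that are connected to it
(eventual strong accuracy). -/
def Trace.EventuallyPerfect {n : ℕ} (E : Trace n) (G : SimpleGraph (Fin n)) : Prop :=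
  ∃ t₀ : ℝ, ∀ t > t₀, ∀ i, E.InForce i t → ∀ p, E.Correct p →
    (∀ q, ¬ ConnectedIn (E.networkGraph G t) p q → q ∈ (E.state i p).suspected) ∧
    (∀ q, ConnectedIn (E.networkGraph G t) p q → q ∉ (E.state i p).suspected)

/-! Neighbours come first. On an ADD channel between correct nodes, the receiver's clock advances by
at most some fixed `M` between receipts. Each repaired suspicion strictly increases the timeout,
while timeouts are eventually bounded by their current value and `2 * M`. So only finitely many
repairs occur, and suspicions of correct neighbours die out. A crashed neighbour sends finitely many
heartbeats, so its timer finally expires for good.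

Other nodes are handled by strong induction on the distance `k` in `Near`, which counts hops of
walks from `r` whose later nodes are all correct; `r` itself may crash
(`eventually_suspectLocal_iff`). The danger is a stored path that looks valid but runs through a
crashed node. By `near_or_of_isPath`, the last crashed node on such a path, if it is not `r`, is
closer to the owner than the path is long, so for short paths the induction hypothesis says that it
is already suspected. Hence eventually no valid-looking path is shorter than the true distance,
while a path of true length is known and looks valid (`exists_eventually_mem_paths`). Thus `p`
copies suspicions only from nodes closer to `r`, whose information is right, and it does copy from a
closer neighbour, which it hears infinitely often.

The derived suspicions follow. If no walk of the above kind joins `r` to `p`, every stored path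
contains a suspected crashed node other than `r`; otherwise some stored path has only correct nodes
apart from `r`.

For the size, stored paths are simple and end at their owner, so they are counted by repetition-free
lists over the other `n - 1` nodes, at most `3 * (n - 1)!` in all. -/

/-! ### Simple paths -/

/-- The list `π` is a simple path of `G` from `r` to `p`. -/
inductive IsPath {n : ℕ} (G : SimpleGraph (Fin n)) (r : Fin n) : Fin n → List (Fin n) → Prop
  | single : IsPath G r r [r]
  | snoc {q p : Fin n} {π : List (Fin n)} :
      IsPath G r q π → G.Adj p q → p ∉ π → IsPath G r p (π ++ [p])

namespace IsPath

variable {n : ℕ} {G : SimpleGraph (Fin n)} {r p : Fin n} {π : List (Fin n)}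

theorem exists_cons (h : IsPath G r p π) : ∃ ρ, π = r :: ρ := by
  induction h with
  | single => exact ⟨[], rfl⟩
  | snoc _ _ _ ih =>
    obtain ⟨ρ, rfl⟩ := ih
    exact ⟨_, List.cons_append⟩

theorem start_mem (h : IsPath G r p π) : r ∈ π := by
  obtain ⟨ρ, rfl⟩ := h.exists_cons
  simp

theorem exists_concat (h : IsPath G r p π) : ∃ ρ, π = ρ ++ [p] := by
  cases h with
  | single => exact ⟨[], rfl⟩
  | snoc _ _ _ => exact ⟨_, rfl⟩

theorem nodup (h : IsPath G r p π) : π.Nodup := by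
  induction h with
  | single => simp
  | snoc _ _ hp ih => exact List.nodup_append.2 ⟨ih, by simp, by rintro a ha b hb rfl; simp_all⟩

theorem length_pos (h : IsPath G r p π) : 0 < π.length :=
  List.length_pos_of_mem h.start_mem

end IsPath

/-! ### The effect of the actions on the variables of a node -/

section Effects

variable {n : ℕ} (p : Fin n) (m : Message n)

theorem foldl_learn_timers (order : List (Fin n)) (s : NodeState n) :
    (order.foldl (learn p m) s).lastContact = s.lastContact ∧
      (order.foldl (learn p m) s).timeout = s.timeout := by
  induction order generalizing s with
  | nil => simp
  | cons a l ih => simpa [learn] using ih (learn p m s a)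

theorem foldl_learn_of_notMem {order : List (Fin n)} (s : NodeState n) {r : Fin n}
    (hr : r ∉ order) :
    (order.foldl (learn p m) s).suspectLocal r = s.suspectLocal r ∧
      (order.foldl (learn p m) s).paths r = s.paths r := by
  induction order generalizing s with
  | nil => simp
  | cons a l ih =>
    simp only [List.mem_cons, not_or] at hr
    obtain ⟨h1, h2⟩ := ih (learn p m s a) hr.2
    rw [List.foldl_cons, h1, h2]
    constructor
    · simp only [learn]
      split <;> simp [hr.1]
    · simp [learn, hr.1]

/-- The witness `s'` is the state of the loop when the turn of `r` comes. Each entry is processed at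
most once, so in `s'` it has either its initial or its final value; this makes the order of the loop
irrelevant later. -/
theorem foldl_learn_of_mem {order : List (Fin n)} (ho : order.Nodup) (s : NodeState n)
    {r : Fin n} (hr : r ∈ order) :
    ∃ s' : NodeState n, s'.paths r = s.paths r ∧
      (∀ x, s'.suspectLocal x = s.suspectLocal x ∨
        s'.suspectLocal x = (order.foldl (learn p m) s).suspectLocal x) ∧
      (order.foldl (learn p m) s).suspectLocal r =
        (if hopFromMsg p m r < hop s' r then m.suspects r else s.suspectLocal r) ∧
      (order.foldl (learn p m) s).paths r =
        s.paths r ∪ ((m.paths r).filter fun π => p ∉ π).image fun π => π ++ [p] := by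
  obtain ⟨l₁, l₂, rfl⟩ := List.append_of_mem hr
  have hr1 : r ∉ l₁ := fun h => (List.disjoint_of_nodup_append ho) h (by simp)
  have hr2 : r ∉ l₂ := (List.nodup_cons.1 (List.nodup_append.1 ho).2.1).1
  obtain ⟨h1, h2⟩ := foldl_learn_of_notMem p m s hr1
  obtain ⟨h3, h4⟩ := foldl_learn_of_notMem p m (learn p m (l₁.foldl (learn p m) s) r) hr2
  refine ⟨l₁.foldl (learn p m) s, h2, fun x => ?_, ?_, ?_⟩
  · by_cases hx : x ∈ l₁
    · right
      have hx2 : x ∉ r :: l₂ := fun h => (List.disjoint_of_nodup_append ho) hx h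
      rw [List.foldl_append, (foldl_learn_of_notMem p m _ hx2).1]
    · exact Or.inl (foldl_learn_of_notMem p m s hx).1
  · rw [List.foldl_append, List.foldl_cons, h3]
    simp only [learn]
    split <;> simp [h1]
  · rw [List.foldl_append, List.foldl_cons, h4]
    simp [learn, h2]

variable {p m} {G : SimpleGraph (Fin n)} {order : List (Fin n)}

theorem receive_timers {q : Fin n} (hq : m.sender = q) (c : ℤ) (s : NodeState n) :
    (receive G p c m order s).lastContact = Function.update s.lastContact q c ∧
      (receive G p c m order s).timeout = if s.suspectLocal q = true
        then Function.update s.timeout q (2 * (c - s.lastContact q)) else s.timeout := by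
  subst hq
  simp [receive, derive, foldl_learn_timers, contact]

theorem receive_of_adj (hmem : ∀ r, r ∈ order ↔ ¬ G.Adj p r) (c : ℤ) (s : NodeState n)
    {r : Fin n} (hr : G.Adj p r) :
    (receive G p c m order s).suspectLocal r =
        Function.update s.suspectLocal m.sender false r ∧
      (receive G p c m order s).paths r = s.paths r := by
  have h : r ∉ order := by simpa [hmem] using hr
  exact foldl_learn_of_notMem p m (contact c m.sender s) h

theorem receive_of_not_adj (ho : order.Nodup) (hmem : ∀ r, r ∈ order ↔ ¬ G.Adj p r) (c : ℤ)
    (s : NodeState n) (hs : G.Adj p m.sender) {r : Fin n} (hr : ¬ G.Adj p r) :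
    ∃ s' : NodeState n, s'.paths r = s.paths r ∧
      (∀ x, s'.suspectLocal x = s.suspectLocal x ∨
        s'.suspectLocal x = (receive G p c m order s).suspectLocal x) ∧
      (receive G p c m order s).suspectLocal r =
        (if hopFromMsg p m r < hop s' r then m.suspects r else s.suspectLocal r) ∧
      (receive G p c m order s).paths r =
        s.paths r ∪ ((m.paths r).filter fun π => p ∉ π).image fun π => π ++ [p] := by
  obtain ⟨s', h1, h2, h3, h4⟩ :=
    foldl_learn_of_mem p m ho (contact c m.sender s) ((hmem r).2 hr)
  have hne : r ≠ m.sender := by rintro rfl; exact hr hs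
  refine ⟨s', h1, fun x => ?_, ?_, h4⟩
  · rcases h2 x with h | h
    -- The entry of the sender is cleared by `contact` before the loop. The sender is a neighbour,
    -- so the loop leaves it alone and the value is already final.
    · by_cases hx : x = m.sender
      · subst hx
        right
        have := (receive_of_adj (m := m) hmem c s hs).1
        rw [this, h]
        simp [contact]
      · left
        simpa [contact, hx] using h
    · exact Or.inr h
  · simpa [contact, hne, receive, derive] using h3

end Effects

/-! ### Steps of an execution -/

namespace Trace

variable {n : ℕ} {E : Trace n} {G : SimpleGraph (Fin n)} {T : Fin n → ℕ}
  {clock : Fin n → LocalClock}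

theorem Correct.live {p : Fin n} (hp : E.Correct p) (i : ℕ) : E.Live i p := fun j _ => hp j

/-- In the `i`-th event, `p` receives a message from `q`. -/
def Received (E : Trace n) (p q : Fin n) (i : ℕ) : Prop := ∃ m, E.event i = Event.recv p q m

namespace IsExecution

theorem step_cases (h : E.IsExecution G T clock) (i : ℕ) (p : Fin n) :
    (E.state (i + 1) p = E.state i p ∧ (∀ q m, E.event i ≠ Event.recv p q m) ∧
      ∀ q, E.event i ≠ Event.timerExpiry p q) ∨
    (∃ q, E.event i = Event.timerExpiry p q ∧ G.Adj p q ∧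
      (E.state i p).timeout q =
        (clock p).reading (E.time (i + 1)) - (E.state i p).lastContact q ∧
      E.state (i + 1) p = expire G p q (E.state i p)) ∨
    (∃ q m, E.event i = Event.recv p q m ∧ G.Adj p q ∧ m < i ∧ E.event m = Event.heartbeat q ∧
      ∃ order : List (Fin n), order.Nodup ∧ (∀ r, r ∈ order ↔ ¬ G.Adj p r) ∧
        E.state (i + 1) p = receive G p ((clock p).reading (E.time (i + 1)))
          ((E.state m q).heartbeat q) order (E.state i p)) := by
  have hs := h.step i
  unfold IsStep at hs
  split at hs
  case h_1 e => simp [e, hs]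
  case h_2 e => simp [e, hs.2]
  case h_3 e => simp [e, hs.2.2]
  case h_4 p' q e =>
    obtain ⟨-, h1, h2, h3⟩ := hs
    by_cases hp : p' = p
    · subst hp
      exact Or.inr (Or.inl ⟨q, e, h1, h2, by simp [h3]⟩)
    · left
      simp [h3, e, hp, Ne.symm hp]
  case h_5 p' q m e =>
    obtain ⟨-, h1, h2, h3, order, h4, h5, h6⟩ := hs
    by_cases hp : p' = p
    · subst hp
      exact Or.inr (Or.inr ⟨q, m, e, h1, h2, h3, order, h4, h5, by simp [h6]⟩)
    · left
      simp [h6, e, hp, Ne.symm hp]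

/-- The possible changes in one step of the variables that `p` keeps for a neighbour `q`. -/
theorem link_step (h : E.IsExecution G T clock) {p q : Fin n} (hpq : G.Adj p q) (i : ℕ) :
    (E.Received p q i ∧ (E.state (i + 1) p).suspectLocal q = false ∧
      (E.state (i + 1) p).lastContact q = (clock p).reading (E.time (i + 1)) ∧
      (E.state (i + 1) p).timeout q = if (E.state i p).suspectLocal q = true
        then 2 * ((clock p).reading (E.time (i + 1)) - (E.state i p).lastContact q)
        else (E.state i p).timeout q) ∨
    (¬ E.Received p q i ∧ E.event i = Event.timerExpiry p q ∧
      (E.state i p).timeout q =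
        (clock p).reading (E.time (i + 1)) - (E.state i p).lastContact q ∧
      (E.state (i + 1) p).suspectLocal q = true ∧
      (E.state (i + 1) p).lastContact q = (E.state i p).lastContact q ∧
      (E.state (i + 1) p).timeout q = (E.state i p).timeout q) ∨
    (¬ E.Received p q i ∧ E.event i ≠ Event.timerExpiry p q ∧
      (E.state (i + 1) p).suspectLocal q = (E.state i p).suspectLocal q ∧
      (E.state (i + 1) p).lastContact q = (E.state i p).lastContact q ∧
      (E.state (i + 1) p).timeout q = (E.state i p).timeout q) := by
  rcases h.step_cases i p with ⟨h1, h2, h3⟩ | ⟨q', h1, h2, h3, h4⟩ |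
    ⟨q', m, h1, h2, -, -, order, h3, h4, h5⟩
  · exact Or.inr (Or.inr ⟨fun ⟨m, hm⟩ => h2 q m hm, h3 q, by simp [h1]⟩)
  · by_cases hq : q' = q
    · subst hq
      exact Or.inr (Or.inl ⟨by simp [Received, h1], h1, h3, by simp [h4, expire, derive]⟩)
    · exact Or.inr (Or.inr ⟨by simp [Received, h1], by simp [h1, hq],
        by simp [h4, expire, derive, Ne.symm hq]⟩)
  · have h6 := (receive_of_adj (m := (E.state m q').heartbeat q') h4
      ((clock p).reading (E.time (i + 1))) (E.state i p) hpq).1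
    obtain ⟨h7, h8⟩ := receive_timers (G := G) (p := p) (m := (E.state m q').heartbeat q')
      (order := order) (q := q') rfl ((clock p).reading (E.time (i + 1))) (E.state i p)
    rw [← h5] at h6 h7 h8
    by_cases hq : q' = q
    · subst hq
      refine Or.inl ⟨⟨m, h1⟩, by simp [h6, NodeState.heartbeat],
        by simp [h7], ?_⟩
      rw [h8]
      split <;> simp
    · refine Or.inr (Or.inr ⟨by simp [Received, h1, hq], by simp [h1], ?_, ?_, ?_⟩)
      · simp [h6, NodeState.heartbeat, Ne.symm hq]
      · simp [h7, Ne.symm hq]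
      · rw [h8]
        split <;> simp [Ne.symm hq]

/-- The induction is strong because a received path comes from the sender's state at the earlier
event `m`. The test `p ∉ π` keeps paths simple. -/
theorem isPath_of_mem_paths (h : E.IsExecution G T clock) (i : ℕ) {p r : Fin n}
    {π : List (Fin n)} (hπ : π ∈ (E.state i p).paths r) : IsPath G r p π := by
  induction i using Nat.strong_induction_on generalizing p r π with
  | _ i ih =>
    cases i with
    | zero =>
      rw [h.state_zero] at hπ
      simp only [initialState] at hπ
      split at hπ
      · simp_all only [Finset.mem_singleton]
        exact .single
      · split at hπ
        · rw [Finset.mem_singleton.1 hπ]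
          exact IsPath.snoc (π := [r]) .single ‹_› (by simpa [eq_comm] using ‹¬ r = p›)
        · simp at hπ
    | succ i =>
      rcases h.step_cases i p with ⟨h1, -, -⟩ | ⟨q, -, -, -, h1⟩ |
        ⟨q, m, -, h2, h3, -, order, h4, h5, h6⟩
      · exact ih i (by omega) (h1 ▸ hπ)
      · exact ih i (by omega) (by simpa [h1, expire, derive] using hπ)
      · rw [h6] at hπ
        by_cases hr : G.Adj p r
        · rw [(receive_of_adj h5 _ _ hr).2] at hπ
          exact ih i (by omega) hπ
        · obtain ⟨-, -, -, -, h7⟩ := receive_of_not_adj (m := (E.state m q).heartbeat q) h4 h5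
            ((clock p).reading (E.time (i + 1))) (E.state i p) h2 hr
          rw [h7, Finset.mem_union, Finset.mem_image] at hπ
          rcases hπ with hπ | ⟨ρ, hρ, rfl⟩
          · exact ih i (by omega) hπ
          · rw [Finset.mem_filter] at hρ
            exact .snoc (ih m (by omega) hρ.1) h2 hρ.2

theorem paths_subset_succ (h : E.IsExecution G T clock) (i : ℕ) (p r : Fin n) :
    (E.state i p).paths r ⊆ (E.state (i + 1) p).paths r := by
  rcases h.step_cases i p with ⟨h1, -, -⟩ | ⟨q, -, -, -, h1⟩ |
    ⟨q, m, -, h2, -, -, order, h4, h5, h6⟩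
  · rw [h1]
  · simp [h1, expire, derive]
  · rw [h6]
    by_cases hr : G.Adj p r
    · rw [(receive_of_adj h5 _ _ hr).2]
    · obtain ⟨-, -, -, -, h7⟩ := receive_of_not_adj (m := (E.state m q).heartbeat q) h4 h5
        ((clock p).reading (E.time (i + 1))) (E.state i p) h2 hr
      rw [h7]
      exact Finset.subset_union_left

theorem paths_mono (h : E.IsExecution G T clock) (p r : Fin n) :
    Monotone fun i => (E.state i p).paths r :=
  monotone_nat_of_le_succ fun i => h.paths_subset_succ i p r

/-- The changes in the entry for a non-neighbour `r` when a message is received. -/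
theorem recv_of_not_adj (h : E.IsExecution G T clock) {i m : ℕ} {p q r : Fin n}
    (hi : E.event i = Event.recv p q m) (hr : ¬ G.Adj p r) :
    ∃ s' : NodeState n, s'.paths r = (E.state i p).paths r ∧
      (∀ x, s'.suspectLocal x = (E.state i p).suspectLocal x ∨
        s'.suspectLocal x = (E.state (i + 1) p).suspectLocal x) ∧
      (E.state (i + 1) p).suspectLocal r =
        (if hopFromMsg p ((E.state m q).heartbeat q) r < hop s' r
          then (E.state m q).suspectLocal r else (E.state i p).suspectLocal r) ∧
      (E.state (i + 1) p).paths r = (E.state i p).paths r ∪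
        (((E.state m q).paths r).filter fun π => p ∉ π).image fun π => π ++ [p] := by
  rcases h.step_cases i p with ⟨-, h1, -⟩ | ⟨q, h1, -⟩ |
    ⟨q', m', h1, h2, -, -, order, h4, h5, h6⟩
  · exact absurd hi (h1 q m)
  · simp [h1] at hi
  · rw [h1] at hi
    obtain ⟨-, rfl, rfl⟩ := Event.recv.inj hi
    rw [h6]
    exact receive_of_not_adj (m := (E.state m' q').heartbeat q') h4 h5 _ _ h2 hr

theorem suspectLocal_succ_of_not_adj (h : E.IsExecution G T clock) {i : ℕ} {p r : Fin n}
    (hi : ∀ q m, E.event i ≠ Event.recv p q m) (hr : ¬ G.Adj p r) :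
    (E.state (i + 1) p).suspectLocal r = (E.state i p).suspectLocal r := by
  rcases h.step_cases i p with ⟨h1, -, -⟩ | ⟨q, -, h2, -, h1⟩ | ⟨q, m, h1, -⟩
  · rw [h1]
  · have : r ≠ q := by rintro rfl; exact hr h2
    simp [h1, expire, derive, this]
  · exact absurd h1 (hi q m)

theorem suspectLocal_self (h : E.IsExecution G T clock) (i : ℕ) (p : Fin n) :
    (E.state i p).suspectLocal p = false := by
  induction i with
  | zero => simp [h.state_zero, initialState]
  | succ i ih =>
    by_cases hi : ∃ q m, E.event i = Event.recv p q m
    · obtain ⟨q, m, hi⟩ := hi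
      obtain ⟨s', -, -, h3, -⟩ := h.recv_of_not_adj hi (G.irrefl (v := p))
      rw [h3, ih, if_neg]
      -- Every path stored for `p` starts at `p`, so none passes the test `p ∉ π`, and `p` never
      -- adopts an opinion about itself.
      have : hopFromMsg p ((E.state m q).heartbeat q) p = ⊤ := by
        rw [hopFromMsg, Finset.filter_false_of_mem, Finset.inf_empty]
        intro π hπ hh
        exact hh.1 (h.isPath_of_mem_paths m hπ).start_mem
      simp [this]
    · push Not at hi
      rw [h.suspectLocal_succ_of_not_adj hi (G.irrefl (v := p)), ih]

/-! ### Fresh messages -/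

theorem recv_spec (h : E.IsExecution G T clock) {i m : ℕ} {p q : Fin n}
    (hi : E.event i = Event.recv p q m) :
    G.Adj p q ∧ m < i ∧ E.event m = Event.heartbeat q := by
  have := h.step i
  rw [IsStep, hi] at this
  exact ⟨this.2.1, this.2.2.1, this.2.2.2.1⟩

/-- What holds from some time on also holds when the messages received after some other time
are sent. -/
theorem eventually_sent (h : E.IsExecution G T clock) {S : ℕ → Prop} (hS : ∀ᶠ m in atTop, S m)
    (p : Fin n) : ∀ᶠ i in atTop, ∀ q m, E.event i = Event.recv p q m → S m := by
  obtain ⟨N, hN⟩ := eventually_atTop.1 hS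
  -- Only finitely many messages are sent before `N`, and each is received at most once.
  have h1 : ∀ᶠ i in atTop, ∀ q, ∀ m ∈ Finset.range N, E.event i ≠ Event.recv p q m := by
    rw [eventually_all]
    intro q
    rw [eventually_all_finset]
    intro m _
    by_cases hm : ∃ j, E.event j = Event.recv p q m
    · obtain ⟨j, hj⟩ := hm
      filter_upwards [eventually_gt_atTop j] with i hi hi'
      exact hi.ne (h.no_duplication _ _ _ _ _ hj hi')
    · push Not at hm
      exact Eventually.of_forall hm
  filter_upwards [h1] with i hi q m hm
  apply hN
  by_contra hlt
  exact hi q m (by simpa using hlt) hm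

theorem eventually_not_heartbeat (h : E.IsExecution G T clock) {q : Fin n} (hq : ¬ E.Correct q) :
    ∀ᶠ m in atTop, E.event m ≠ Event.heartbeat q := by
  simp only [Correct, not_forall, not_not] at hq
  obtain ⟨j, hj⟩ := hq
  filter_upwards [eventually_gt_atTop j] with m hm hm'
  have := h.step m
  rw [IsStep, hm'] at this
  exact this.1 j hm hj

theorem eventually_sender_correct (h : E.IsExecution G T clock) (p : Fin n) :
    ∀ᶠ i in atTop, ∀ q m, E.event i = Event.recv p q m → E.Correct q := by
  have h1 : ∀ᶠ m in atTop, ∀ q, ¬ E.Correct q → E.event m ≠ Event.heartbeat q := by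
    rw [eventually_all]
    intro q
    rw [eventually_imp_distrib_left]
    exact h.eventually_not_heartbeat
  filter_upwards [h.eventually_sent h1 p] with i hi q m hm
  by_contra hq
  exact hi q m hm q hq (h.recv_spec hm).2.2

end IsExecution
end Trace

/-! ### Conversion between real time and clock readings -/

namespace LocalClock

theorem reading_mono (c : LocalClock) : Monotone c.reading := fun _ _ h =>
  Int.floor_le_floor (by have := mul_le_mul_of_nonneg_left h c.rate_pos.le; linarith)

theorem tendsto_reading (c : LocalClock) : Tendsto c.reading atTop atTop :=
  tendsto_floor_atTop.comp
    (tendsto_atTop_add_const_left _ _ (tendsto_id.const_mul_atTop c.rate_pos))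

theorem reading_add_le (c : LocalClock) (t d : ℝ) :
    c.reading (t + d) ≤ c.reading t + (⌈c.rate * d⌉ + 1) := by
  have h1 := Int.lt_floor_add_one (c.offset + c.rate * t)
  have h2 := Int.le_ceil (c.rate * d)
  have h3 := Int.floor_le (c.offset + c.rate * (t + d))
  have h4 : ((⌊c.offset + c.rate * (t + d)⌋ : ℤ) : ℝ) ≤
      ((⌊c.offset + c.rate * t⌋ + (⌈c.rate * d⌉ + 1) : ℤ) : ℝ) := by
    push_cast
    linarith
  exact_mod_cast h4

theorem le_of_reading_le (c : LocalClock) {s t : ℝ} {x : ℤ}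
    (h : c.reading s ≤ c.reading t + x) : s ≤ t + (x + 1) / c.rate := by
  have h1 := Int.lt_floor_add_one (c.offset + c.rate * s)
  have h2 := Int.floor_le (c.offset + c.rate * t)
  have h3 : ((⌊c.offset + c.rate * s⌋ : ℤ) : ℝ) ≤ ⌊c.offset + c.rate * t⌋ + x := by
    exact_mod_cast h
  have h4 : c.rate * (s - t) ≤ x + 1 := by linarith
  have h5 : s - t ≤ (x + 1) / c.rate := by
    rw [le_div_iff₀ c.rate_pos]
    linarith
  linarith

end LocalClock

namespace Trace

variable {n : ℕ} {E : Trace n} {G : SimpleGraph (Fin n)} {T : Fin n → ℕ}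
  {clock : Fin n → LocalClock}

namespace IsExecution

/-! ### Clocks -/

theorem reading_mono (h : E.IsExecution G T clock) (p : Fin n) :
    Monotone fun i => (clock p).reading (E.time i) :=
  (clock p).reading_mono.comp h.time_mono

theorem tendsto_reading (h : E.IsExecution G T clock) (p : Fin n) :
    Tendsto (fun i => (clock p).reading (E.time i)) atTop atTop :=
  (clock p).tendsto_reading.comp h.time_unbounded

theorem exists_leaves (h : E.IsExecution G T clock) (p : Fin n) {c : ℤ}
    (hc : (clock p).reading (E.time 0) ≤ c) :
    ∃ i, (clock p).reading (E.time i) ≤ c ∧ c < (clock p).reading (E.time (i + 1)) := by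
  have hex : ∃ i, c < (clock p).reading (E.time i) :=
    ((h.tendsto_reading p).eventually_gt_atTop c).exists
  classical
  obtain ⟨i, hi⟩ := Nat.exists_eq_succ_of_ne_zero (n := Nat.find hex) (by
    intro h0
    have := Nat.find_spec hex
    rw [h0] at this
    omega)
  refine ⟨i, ?_, ?_⟩
  · exact not_lt.1 (Nat.find_min hex (m := i) (by omega))
  · have := Nat.find_spec hex
    rwa [hi] at this

/-- The clock starts at or below `T q`, so it has to pass every positive multiple of the period. The
multiple `0` is excluded because the clock may start above it. -/
theorem exists_heartbeat (h : E.IsExecution G T clock)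
    (hT0 : ∀ p, (clock p).reading 0 ≤ T p) {q : Fin n} (hq : E.Correct q) {k : ℕ} (hk : 0 < k) :
    ∃ j, E.event j = Event.heartbeat q ∧ (clock q).reading (E.time (j + 1)) = k * T q := by
  have h0 : (clock q).reading (E.time 0) ≤ k * T q := by
    rw [h.time_zero]
    refine (hT0 q).trans ?_
    have : 1 * T q ≤ k * T q := Nat.mul_le_mul_right _ hk
    exact_mod_cast (one_mul (T q)) ▸ this
  obtain ⟨i, h1, h2⟩ := h.exists_leaves q h0
  obtain ⟨j, -, h3⟩ := h.heartbeat_performed i q k (hq.live i) h1 h2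
  exact ⟨j, h3⟩

/-! ### Receipts on an ADD channel between correct nodes -/

/-- From some time on, a privileged message is sent in every period of a fixed length. -/
theorem exists_privileged (h : E.IsExecution G T clock) (hT : ∀ p, 0 < T p)
    (hT0 : ∀ p, (clock p).reading 0 ≤ T p) {q : Fin n} (hq : E.Correct q) {r : ℕ}
    {priv : Set ℕ} (hr : ∀ a b : ℕ, (∀ m, a ≤ m → m < b → m ∉ priv) →
      {m | a ≤ m ∧ m < b ∧ E.event m = Event.heartbeat q}.ncard ≤ r) :
    ∃ D : ℝ, ∀ᶠ a in atTop, ∃ m ≥ a, m ∈ priv ∧ E.time (m + 1) ≤ E.time a + D := by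
  -- The next `r + 1` heartbeats take at most `(r + 1) * T q` ticks, and one of them is privileged;
  -- the extra tick absorbs the rounding of the clock.
  refine ⟨((((r + 1) * T q : ℕ) : ℤ) + 1) / (clock q).rate, ?_⟩
  filter_upwards [(h.tendsto_reading q).eventually_ge_atTop 0] with a ha
  obtain ⟨c, hc⟩ := Int.eq_ofNat_of_zero_le ha
  have hTq := hT q
  -- `j x` is a heartbeat at the `x`-th multiple of the period strictly above the reading `c`,
  -- counted from `0`; strictness places it at or after `a`.
  have hk (x : ℕ) : ∃ j, E.event j = Event.heartbeat q ∧
      (clock q).reading (E.time (j + 1)) = ((c / T q + 1 + x : ℕ) : ℤ) * T q :=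
    h.exists_heartbeat hT0 hq (Nat.add_pos_left (Nat.succ_pos _) x)
  choose j hj1 hj2 using hk
  have hmono : StrictMono j := by
    intro x y hxy
    have h1 : (clock q).reading (E.time (j x + 1)) < (clock q).reading (E.time (j y + 1)) := by
      rw [hj2, hj2]
      have : (c / T q + 1 + x) * T q < (c / T q + 1 + y) * T q :=
        Nat.mul_lt_mul_of_pos_right (by omega) hTq
      exact_mod_cast this
    have := (h.reading_mono q).reflect_lt h1
    omega
  have hge : ∀ x, a ≤ j x := by
    intro x
    have h1 : (clock q).reading (E.time a) < (clock q).reading (E.time (j x + 1)) := by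
      rw [hj2, hc]
      have h2 : c < (c / T q + 1) * T q := by
        rw [mul_comm]
        exact Nat.lt_mul_div_succ c hTq
      have h3 : (c / T q + 1) * T q ≤ (c / T q + 1 + x) * T q :=
        Nat.mul_le_mul_right _ (by omega)
      exact_mod_cast h2.trans_le h3
    have := (h.reading_mono q).reflect_lt h1
    omega
  have hpriv : ∃ m, a ≤ m ∧ m < j r + 1 ∧ m ∈ priv := by
    by_contra! hcon
    have h1 := hr a (j r + 1) hcon
    have hfin : {m | a ≤ m ∧ m < j r + 1 ∧ E.event m = Event.heartbeat q}.Finite :=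
      (Set.finite_Iio (j r + 1)).subset fun m hm => hm.2.1
    have h2 : ((Finset.range (r + 1)).image j : Set ℕ) ⊆
        {m | a ≤ m ∧ m < j r + 1 ∧ E.event m = Event.heartbeat q} := by
      intro m hm
      simp only [Finset.coe_image, Set.mem_image, Finset.coe_range, Set.mem_Iio] at hm
      obtain ⟨x, hx, rfl⟩ := hm
      exact ⟨hge x, Nat.lt_succ_of_le (hmono.monotone (by omega)), hj1 x⟩
    have h3 := Set.ncard_le_ncard h2 hfin
    rw [Set.ncard_coe_finset, Finset.card_image_of_injective _ hmono.injective,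
      Finset.card_range] at h3
    omega
  obtain ⟨m, h1, h2, h3⟩ := hpriv
  refine ⟨m, h1, h3, (h.time_mono (show m + 1 ≤ j r + 1 by omega)).trans ?_⟩
  apply (clock q).le_of_reading_le
  rw [hj2, hc]
  have h4 : (c / T q + 1 + r) * T q ≤ c + (r + 1) * T q := by
    have := Nat.div_mul_le_self c (T q)
    nlinarith
  exact_mod_cast h4

/-- From some time on, a correct node receives a message from a correct neighbour in every period
of a fixed length of its clock. -/
theorem exists_received (h : E.IsExecution G T clock) (hT : ∀ p, 0 < T p)
    (hT0 : ∀ p, (clock p).reading 0 ≤ T p) {p q : Fin n} (hadd : E.IsADDChannel q p)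
    (hp : E.Correct p) (hq : E.Correct q) :
    ∃ M : ℤ, ∀ᶠ a in atTop, ∃ i ≥ a, E.Received p q i ∧
      (clock p).reading (E.time (i + 1)) ≤ (clock p).reading (E.time a) + M := by
  obtain ⟨d, r, priv, -, h2, h3⟩ := hadd
  obtain ⟨D, hD⟩ := h.exists_privileged hT hT0 hq h3
  -- At most `D` passes until a privileged message is sent and at most `d` until it arrives.
  refine ⟨⌈(clock p).rate * (D + d)⌉ + 1, hD.mono fun a ha => ?_⟩
  obtain ⟨m, hm1, hm2, hm3⟩ := ha
  obtain ⟨i, hi1, hi2⟩ := h2 m hm2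
  rcases hi1 with hi1 | hi1
  · refine ⟨i, hm1.trans (h.recv_spec hi1).2.1.le, ⟨m, hi1⟩, ?_⟩
    refine le_trans ((clock p).reading_mono ?_) ((clock p).reading_add_le (E.time a) (D + d))
    linarith
  · exact absurd hi1 (hp i)

theorem frequently_received (h : E.IsExecution G T clock) (hT : ∀ p, 0 < T p)
    (hT0 : ∀ p, (clock p).reading 0 ≤ T p) {p q : Fin n} (hadd : E.IsADDChannel q p)
    (hp : E.Correct p) (hq : E.Correct q) : ∃ᶠ i in atTop, E.Received p q i := by
  obtain ⟨M, hM⟩ := h.exists_received hT hT0 hadd hp hq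
  rw [frequently_atTop]
  intro a
  obtain ⟨b, hb, i, hi, hi', -⟩ := ((eventually_ge_atTop a).and hM).exists
  exact ⟨i, hb.trans hi, hi'⟩

/-! ### Suspicions of neighbours -/

section Neighbour

variable {p q : Fin n}

/-- The two halves support each other: while `q` is suspected, the elapsed time is at least the
positive timeout, so the doubled value set at a repair is positive again. -/
theorem timeout_pos (h : E.IsExecution G T clock) (hT : ∀ p, 0 < T p) (hpq : G.Adj p q) (i : ℕ) :
    0 < (E.state i p).timeout q ∧ ((E.state i p).suspectLocal q = true →
      (E.state i p).timeout q ≤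
        (clock p).reading (E.time i) - (E.state i p).lastContact q) := by
  induction i with
  | zero => simpa [h.state_zero, initialState] using hT p
  | succ i ih =>
    have hm := h.reading_mono p (Nat.le_succ i)
    simp only [Nat.succ_eq_add_one] at hm
    rcases h.link_step hpq i with ⟨-, h2, h3, h4⟩ | ⟨-, -, h1, h2, h3, h4⟩ | ⟨-, -, h2, h3, h4⟩
    · rw [h2, h4]
      refine ⟨?_, by simp⟩
      split
      · have := ih.2 ‹_›
        omega
      · exact ih.1
    · rw [h2, h3, h4]
      exact ⟨ih.1, fun _ => h1.le⟩
    · rw [h2, h3, h4]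
      exact ⟨ih.1, fun hs => (ih.2 hs).trans (by omega)⟩

/-- A neighbour is suspected as soon as its timer has run out. -/
theorem reading_le_deadline (h : E.IsExecution G T clock) (hT : ∀ p, 0 < T p)
    (hT0 : ∀ p, (clock p).reading 0 ≤ T p) (hp : E.Correct p) (hpq : G.Adj p q) (i : ℕ)
    (hi : (E.state i p).suspectLocal q = false) :
    (clock p).reading (E.time i) ≤
      (E.state i p).lastContact q + (E.state i p).timeout q := by
  induction i with
  | zero => simpa [h.state_zero, initialState, h.time_zero] using hT0 p
  | succ i ih =>
    rcases h.link_step hpq i with ⟨-, -, h3, -⟩ | ⟨-, -, -, h2, -⟩ | ⟨-, -, h2, h3, h4⟩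
    · have := (h.timeout_pos hT hpq (i + 1)).1
      omega
    · simp [hi] at h2
    · rw [h2] at hi
      rw [h3, h4]
      by_contra! hlt
      obtain ⟨j, hj1, hj2, hj3⟩ :=
        h.timer_performed i p q _ (hp.live i) hpq (ih hi) hlt (by ring)
      -- After the expiry at the deadline, only a receipt can end the suspicion. It then happens
      -- while the clock still shows the deadline, so `lastContact` equals the deadline and the
      -- timeout at `i` would be zero.
      have key : ∀ l, j + 1 ≤ l → l ≤ i → (E.state l p).suspectLocal q = true ∨
          (E.state l p).lastContact q = (clock p).reading (E.time (j + 1)) := by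
        intro l hl
        induction l, hl using Nat.le_induction with
        | base =>
          intro _
          rcases h.link_step hpq j with ⟨⟨m, h1⟩, -⟩ | ⟨-, -, -, h2, -⟩ | ⟨-, h1, -⟩
          · simp [hj2] at h1
          · exact Or.inl h2
          · exact absurd hj2 h1
        | succ l hl ihl =>
          intro hli
          rcases h.link_step hpq l with ⟨-, -, h5, -⟩ | ⟨-, -, -, h5, -⟩ | ⟨-, -, h5, h6, -⟩
          · right
            rw [h5]
            have h7 := h.reading_mono p (show j + 1 ≤ l + 1 by omega)
            have h8 := h.reading_mono p hli
            have h9 := ih hi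
            simp only at h7 h8
            omega
          · exact Or.inl h5
          · rw [h5, h6]
            exact ihl (by omega)
      rcases key i (by omega) le_rfl with h5 | h5
      · simp [hi] at h5
      · have := (h.timeout_pos hT hpq i).1
        omega

theorem eventually_suspectLocal_of_not_correct (h : E.IsExecution G T clock) (hT : ∀ p, 0 < T p)
    (hT0 : ∀ p, (clock p).reading 0 ≤ T p) (hp : E.Correct p) (hpq : G.Adj p q)
    (hq : ¬ E.Correct q) : ∀ᶠ i in atTop, (E.state i p).suspectLocal q = true := by
  obtain ⟨N, hN⟩ := eventually_atTop.1 (h.eventually_sender_correct p)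
  have hrec : ∀ i ≥ N, ¬ E.Received p q i := fun i hi ⟨m, hm⟩ => hq (hN i hi q m hm)
  -- Without receipts, `lastContact` and `timeout` are frozen, and the clock would overrun the fixed
  -- deadline.
  have hex : ∃ k ≥ N, (E.state k p).suspectLocal q = true := by
    by_contra! hcon
    have hconst : ∀ k ≥ N, (E.state k p).lastContact q = (E.state N p).lastContact q ∧
        (E.state k p).timeout q = (E.state N p).timeout q := by
      intro k hk
      induction k, hk using Nat.le_induction with
      | base => simp
      | succ k hk ih =>
        rcases h.link_step hpq k with ⟨h1, -⟩ | ⟨-, -, -, -, h3, h4⟩ | ⟨-, -, -, h3, h4⟩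
        · exact absurd h1 (hrec k hk)
        · rwa [h3, h4]
        · rwa [h3, h4]
    obtain ⟨k, hk1, hk2⟩ := (((h.tendsto_reading p).eventually_gt_atTop
      ((E.state N p).lastContact q + (E.state N p).timeout q)).and
        (eventually_ge_atTop N)).exists
    have := h.reading_le_deadline hT hT0 hp hpq k (by simpa using hcon k hk2)
    rw [(hconst k hk2).1, (hconst k hk2).2] at this
    omega
  obtain ⟨k, hk, hk'⟩ := hex
  filter_upwards [eventually_ge_atTop k] with i hi
  induction i, hi using Nat.le_induction with
  | base => exact hk'
  | succ i hi ih =>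
    rcases h.link_step hpq i with ⟨h1, -⟩ | ⟨-, -, -, h2, -⟩ | ⟨-, -, h2, -⟩
    · exact absurd h1 (hrec i (by omega))
    · exact h2
    · rw [h2, ih]

/-- The timeout for a neighbour never decreases, and increases when a suspicion is repaired. -/
theorem timeout_succ (h : E.IsExecution G T clock) (hT : ∀ p, 0 < T p) (hpq : G.Adj p q) (i : ℕ) :
    (E.state i p).timeout q ≤ (E.state (i + 1) p).timeout q ∧
      (E.Received p q i → (E.state i p).suspectLocal q = true →
        (E.state i p).timeout q < (E.state (i + 1) p).timeout q) := by
  obtain ⟨h5, h6⟩ := h.timeout_pos hT hpq i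
  have hm := h.reading_mono p (Nat.le_succ i)
  simp only [Nat.succ_eq_add_one] at hm
  rcases h.link_step hpq i with ⟨-, -, -, h4⟩ | ⟨h1, -, -, -, -, h4⟩ | ⟨h1, -, -, -, h4⟩
  · rw [h4]
    split
    · have := h6 ‹_›
      exact ⟨by omega, fun _ _ => by omega⟩
    · exact ⟨le_rfl, fun _ hs => absurd hs ‹_›⟩
  · exact ⟨h4.ge, fun hr => absurd hr h1⟩
  · exact ⟨h4.ge, fun hr => absurd hr h1⟩

theorem exists_timeout_bound (h : E.IsExecution G T clock) (hT : ∀ p, 0 < T p)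
    (hT0 : ∀ p, (clock p).reading 0 ≤ T p) (hadd : E.IsADDChannel q p)
    (hp : E.Correct p) (hpq : G.Adj p q) (hq : E.Correct q) :
    ∃ (B : ℤ) (N : ℕ), ∀ i ≥ N, (E.state i p).timeout q ≤ B := by
  obtain ⟨M, hM⟩ := h.exists_received hT hT0 hadd hp hq
  obtain ⟨a, ha⟩ := eventually_atTop.1 hM
  obtain ⟨b, hb, hb', -⟩ := ha a le_rfl
  -- Starting after the receipt at `b` ensures that `lastContact` is the time of a receipt to which
  -- the gap bound `M` applies.
  have hnext : ∀ k ≥ b + 1, ∃ i ≥ k, E.Received p q i ∧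
      (clock p).reading (E.time (i + 1)) ≤ (E.state k p).lastContact q + M := by
    have hrec : ∀ k ≥ b, E.Received p q k → ∃ i ≥ k + 1, E.Received p q i ∧
        (clock p).reading (E.time (i + 1)) ≤ (E.state (k + 1) p).lastContact q + M := by
      intro k hk hr
      rcases h.link_step hpq k with ⟨-, -, h3, -⟩ | ⟨h1, -⟩ | ⟨h1, -⟩
      · rw [h3]
        exact ha (k + 1) (by omega)
      · exact absurd hr h1
      · exact absurd hr h1
    intro k hk
    induction k, hk using Nat.le_induction with
    | base => exact hrec b le_rfl hb'
    | succ k hk ih =>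
      by_cases hr : E.Received p q k
      · exact hrec k (by omega) hr
      · obtain ⟨i, hi, hi', hi''⟩ := ih
        have hne : i ≠ k := by rintro rfl; exact hr hi'
        refine ⟨i, by omega, hi', ?_⟩
        rcases h.link_step hpq k with ⟨h1, -⟩ | ⟨-, -, -, -, h3, -⟩ | ⟨-, -, -, h3, -⟩
        · exact absurd h1 hr
        · rwa [h3]
        · rwa [h3]
  refine ⟨max ((E.state (b + 1) p).timeout q) (2 * M), b + 1, fun i hi => ?_⟩
  induction i, hi using Nat.le_induction with
  | base => exact le_max_left _ _
  | succ i hi ih =>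
    rcases h.link_step hpq i with ⟨-, -, -, h4⟩ | ⟨-, -, -, -, -, h4⟩ | ⟨-, -, -, -, h4⟩
    · rw [h4]
      split
      · obtain ⟨j, hj, -, hj'⟩ := hnext i hi
        have h5 := h.reading_mono p (show i + 1 ≤ j + 1 by omega)
        simp only at h5
        exact le_max_of_le_right (by omega)
      · exact ih
    · rwa [h4]
    · rwa [h4]

theorem eventually_not_suspectLocal_of_correct (h : E.IsExecution G T clock)
    (hT : ∀ p, 0 < T p) (hT0 : ∀ p, (clock p).reading 0 ≤ T p) (hadd : E.IsADDChannel q p)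
    (hp : E.Correct p) (hpq : G.Adj p q) (hq : E.Correct q) :
    ∀ᶠ i in atTop, (E.state i p).suspectLocal q = false := by
  obtain ⟨B, N, hB⟩ := h.exists_timeout_bound hT hT0 hadd hp hpq hq
  have hmono : Monotone fun i => (E.state i p).timeout q :=
    monotone_nat_of_le_succ fun i => (h.timeout_succ hT hpq i).1
  -- A bounded set of integers has a greatest element. Once the timeout attains it at `K`, no repair
  -- can happen, so any later suspicion would be permanent although messages keep arriving.
  obtain ⟨_, ⟨K, hK, rfl⟩, hmax⟩ := Int.exists_greatest_of_bdd
    (P := fun z => ∃ k ≥ N, (E.state k p).timeout q = z)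
    ⟨B, by rintro _ ⟨k, hk, rfl⟩; exact hB k hk⟩ ⟨_, N, le_rfl, rfl⟩
  have hrep : ∀ i ≥ K, E.Received p q i → ¬ (E.state i p).suspectLocal q = true := by
    intro i hi hr hs
    have h1 := (h.timeout_succ hT hpq i).2 hr hs
    have h2 := hmax _ ⟨i + 1, by omega, rfl⟩
    have h3 := hmono hi
    simp only at h3
    omega
  filter_upwards [eventually_ge_atTop K] with k hk
  by_contra hs
  have hstay : ∀ i ≥ k, (E.state i p).suspectLocal q = true := by
    intro i hi
    induction i, hi using Nat.le_induction with
    | base => simpa using hs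
    | succ i hi ih =>
      rcases h.link_step hpq i with ⟨h1, -⟩ | ⟨-, -, -, h2, -⟩ | ⟨-, -, h2, -⟩
      · exact absurd ih (hrep i (by omega) h1)
      · exact h2
      · rw [h2, ih]
  obtain ⟨i, hi, hi'⟩ :=
    frequently_atTop.1 (h.frequently_received hT hT0 hadd hp hq) k
  exact hrep i (by omega) hi' (hstay i hi)

end Neighbour

end IsExecution
end Trace

/-! ### The size of messages -/

/-- Splitting off the head gives the recursion `a s ≤ 1 + s * a (s - 1)`. The bound `3 * s!` alone
is not inductive; `3 * s! - 1` is for `s ≥ 2`. The term `0 ^ S.card` sharpens the case `s = 0` to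
the exact value `1`, as the step to `s = 1` requires. -/
theorem card_lists_le_of_nodup {α : Type*} [DecidableEq α] (S : Finset α)
    (A : Finset (List α)) (hA : ∀ l ∈ A, l.Nodup ∧ ∀ x ∈ l, x ∈ S) :
    A.card + 1 + 0 ^ S.card ≤ 3 * S.card.factorial := by
  induction hs : S.card using Nat.strong_induction_on generalizing S A with
  | _ s ih =>
    have hsub : A ⊆ insert [] (S.biUnion fun x =>
        (A.filter fun l => l.head? = some x)) := by
      intro l hl
      cases l with
      | nil => simp
      | cons x l =>
        simp only [Finset.mem_insert, Finset.mem_biUnion, Finset.mem_filter]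
        exact Or.inr ⟨x, (hA _ hl).2 x (by simp), hl, rfl⟩
    have hcard : ∀ x ∈ S, (A.filter fun l => l.head? = some x).card + 1 + 0 ^ (s - 1) ≤
        3 * (s - 1).factorial := by
      intro x hx
      have hpos : 0 < S.card := Finset.card_pos.2 ⟨x, hx⟩
      have h1 : ((A.filter fun l => l.head? = some x).image List.tail).card =
          (A.filter fun l => l.head? = some x).card := by
        apply Finset.card_image_of_injOn
        intro l hl l' hl' heq
        rw [Finset.mem_coe, Finset.mem_filter] at hl hl'
        cases l <;> cases l' <;> simp_all
      rw [← h1]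
      refine ih (s - 1) (by omega) (S.erase x) _ ?_ (by rw [Finset.card_erase_of_mem hx, hs])
      intro l hl
      simp only [Finset.mem_image, Finset.mem_filter] at hl
      obtain ⟨l', ⟨hl', hh⟩, rfl⟩ := hl
      cases l' with
      | nil => simp at hh
      | cons y l' =>
        obtain rfl : y = x := by simpa using hh
        obtain ⟨h2, h3⟩ := hA _ hl'
        rw [List.nodup_cons] at h2
        refine ⟨h2.2, fun z hz => Finset.mem_erase.2 ⟨?_, h3 z (List.mem_cons_of_mem _ hz)⟩⟩
        rintro rfl
        exact h2.1 hz
    have h2 : A.card ≤ 1 + S.card * (3 * (s - 1).factorial - 1 - 0 ^ (s - 1)) := by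
      refine (Finset.card_le_card hsub).trans ((Finset.card_insert_le _ _).trans ?_)
      rw [add_comm]
      refine Nat.add_le_add_left (Finset.card_biUnion_le_card_mul _ _ _ fun x hx => ?_) 1
      have := hcard x hx
      lia
    rw [hs] at h2
    rcases s with _ | _ | s
    · simp at h2 ⊢
      lia
    · simp at h2 ⊢
      lia
    · rw [Nat.factorial_succ (s + 1)]
      have h3 : 0 < (s + 1).factorial := Nat.factorial_pos _
      simp only [Nat.add_sub_cancel, ne_eq, Nat.add_eq_zero_iff, one_ne_zero, and_false,
        not_false_eq_true, zero_pow, Nat.sub_zero, Nat.add_zero] at h2 ⊢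
      obtain ⟨f, hf⟩ := Nat.exists_eq_add_of_lt h3
      rw [hf] at h2 ⊢
      have h4 : 3 * (0 + f + 1) - 1 = 3 * f + 2 := by omega
      rw [h4] at h2
      nlinarith

theorem length_encodePath {n : ℕ} (π : List (Fin n)) :
    (encodePath π).length = π.length * (Nat.clog 2 n + 1) + 1 := by
  simp [encodePath, encodeId, List.length_flatMap]

theorem length_encodePathList_le {n : ℕ} {L : List (List (Fin n))} {b : ℕ}
    (hL : ∀ π ∈ L, π.length ≤ b) :
    (encodePathList L).length ≤ L.length * (b * (Nat.clog 2 n + 1) + 2) + 1 := by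
  simp only [encodePathList, List.length_append, List.length_flatMap, List.length_cons,
    List.length_nil, length_encodePath]
  refine Nat.add_le_add_right ?_ _
  have h1 : ∀ x ∈ L.map fun π => π.length * (Nat.clog 2 n + 1) + 1 + 1,
      x ≤ b * (Nat.clog 2 n + 1) + 2 := by
    intro x hx
    obtain ⟨π, hπ, rfl⟩ := List.mem_map.1 hx
    have := Nat.mul_le_mul_right (Nat.clog 2 n + 1) (hL π hπ)
    omega
  simpa using List.sum_le_card_nsmul _ _ h1

theorem Message.bits_le {n : ℕ} (m : Message n) {b : ℕ}
    (hm : ∀ r, ∀ π ∈ m.paths r, π.length ≤ b) :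
    m.bits ≤ 2 * n + Nat.clog 2 n +
      (∑ r, (m.paths r).card) * (b * (Nat.clog 2 n + 1) + 2) := by
  have h1 : (((List.finRange n).flatMap fun r => encodePathList (m.paths r).toList)).length ≤
      ∑ r, ((m.paths r).card * (b * (Nat.clog 2 n + 1) + 2) + 1) := by
    rw [List.length_flatMap, ← List.ofFn_eq_map, List.sum_ofFn]
    refine Finset.sum_le_sum fun r _ => ?_
    rw [← Finset.length_toList]
    exact length_encodePathList_le fun π hπ => hm r π (Finset.mem_toList.1 hπ)
  rw [Finset.sum_add_distrib, ← Finset.sum_mul] at h1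
  simp only [Finset.sum_const, Finset.card_univ, Fintype.card_fin, smul_eq_mul, mul_one] at h1
  simp only [Message.bits, Message.encode, List.length_append, List.length_ofFn, encodeId]
  omega

/-- The number of simple paths that end at a given node. -/
theorem sum_card_paths_le {n : ℕ} {G : SimpleGraph (Fin n)} {p : Fin n}
    (f : Fin n → Finset (List (Fin n))) (hf : ∀ r, ∀ π ∈ f r, IsPath G r p π) :
    ∑ r, (f r).card ≤ 3 * (n - 1).factorial := by
  have hdisj : (↑(Finset.univ : Finset (Fin n)) : Set (Fin n)).PairwiseDisjoint f := by
    intro r _ r' _ hne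
    rw [Function.onFun, Finset.disjoint_left]
    intro π h1 h2
    obtain ⟨ρ, rfl⟩ := (hf r π h1).exists_cons
    obtain ⟨ρ', h3⟩ := (hf r' _ h2).exists_cons
    exact hne (List.cons.inj h3).1
  rw [← Finset.card_biUnion fun r hr r' hr' hne => hdisj hr hr' hne]
  have hpath : ∀ π ∈ Finset.univ.biUnion f, ∃ r, IsPath G r p π := by
    intro π hπ
    obtain ⟨r, -, hr⟩ := Finset.mem_biUnion.1 hπ
    exact ⟨r, hf r π hr⟩
  -- All these paths end at `p`, so removing the last node loses nothing and leaves a list that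
  -- avoids `p`.
  have hinj : Set.InjOn List.dropLast (↑(Finset.univ.biUnion f) : Set (List (Fin n))) := by
    intro π hπ π' hπ' heq
    obtain ⟨r, hr⟩ := hpath π hπ
    obtain ⟨r', hr'⟩ := hpath π' hπ'
    obtain ⟨ρ, rfl⟩ := hr.exists_concat
    obtain ⟨ρ', rfl⟩ := hr'.exists_concat
    simpa using heq
  rw [← Finset.card_image_of_injOn hinj]
  have h1 := card_lists_le_of_nodup (Finset.univ.erase p)
    ((Finset.univ.biUnion f).image List.dropLast) (by
      intro l hl
      obtain ⟨π, hπ, rfl⟩ := Finset.mem_image.1 hl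
      obtain ⟨r, hr⟩ := hpath π hπ
      have hn := hr.nodup
      obtain ⟨ρ, rfl⟩ := hr.exists_concat
      rw [List.dropLast_concat]
      rw [List.nodup_append] at hn
      refine ⟨hn.1, fun x hx => Finset.mem_erase.2 ⟨?_, Finset.mem_univ _⟩⟩
      exact fun hxp => hn.2.2 x hx p (by simp) hxp)
  rw [Finset.card_erase_of_mem (Finset.mem_univ p), Finset.card_univ, Fintype.card_fin] at h1
  exact (Nat.le_add_right _ _).trans ((Nat.le_add_right _ _).trans h1)

/-- There are at most `3 * (n - 1)!` paths, each with at most `n` names of at most `n` bits, marker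
included. Since `n * (n + 1) * (n - 1)! = (n + 1)!`, a constant factor suffices; `10` is not
optimal. -/
theorem Trace.IsExecution.bits_heartbeat_le {n : ℕ} {E : Trace n} {G : SimpleGraph (Fin n)}
    {T : Fin n → ℕ} {clock : Fin n → LocalClock} (h : E.IsExecution G T clock) (i : ℕ)
    (p : Fin n) : ((E.state i p).heartbeat p).bits ≤ 10 * (n + 1).factorial := by
  have h1 := Message.bits_le ((E.state i p).heartbeat p) (b := n) (fun r π hπ => by
    simpa using (h.isPath_of_mem_paths i hπ).nodup.length_le_card)
  have h2 := sum_card_paths_le ((E.state i p).heartbeat p).paths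
    (fun r π hπ => h.isPath_of_mem_paths i hπ)
  obtain ⟨k, rfl⟩ : ∃ k, n = k + 1 := ⟨n - 1, by have := p.isLt; omega⟩
  have h3 : Nat.clog 2 (k + 1) ≤ k := Nat.clog_le_of_le_pow Nat.lt_two_pow_self
  rw [Nat.factorial_succ, Nat.factorial_succ]
  simp only [Nat.add_sub_cancel] at h2
  have h4 : 0 < k.factorial := Nat.factorial_pos k
  have h5 : (k + 1) * (Nat.clog 2 (k + 1) + 1) + 2 ≤ (k + 1) * (k + 1) + 2 := by gcongr
  have h6 := Nat.mul_le_mul h2 h5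
  have h7 : 2 * (k + 1) + k ≤ (2 * (k + 1) + k) * k.factorial := Nat.le_mul_of_pos_right _ h4
  have h8 : (2 * (k + 1) + k) * k.factorial + 3 * k.factorial * ((k + 1) * (k + 1) + 2) ≤
      10 * ((k + 1 + 1) * ((k + 1) * k.factorial)) := by
    have : (2 * (k + 1) + k) + 3 * ((k + 1) * (k + 1) + 2) ≤ 10 * ((k + 1 + 1) * (k + 1)) := by
      nlinarith
    calc _ = ((2 * (k + 1) + k) + 3 * ((k + 1) * (k + 1) + 2)) * k.factorial := by ring
      _ ≤ (10 * ((k + 1 + 1) * (k + 1))) * k.factorial := Nat.mul_le_mul_right _ this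
      _ = _ := by ring
  omega

namespace Trace

variable {n : ℕ} {E : Trace n} {G : SimpleGraph (Fin n)} {T : Fin n → ℕ}
  {clock : Fin n → LocalClock}

/-! ### Distances along correct nodes -/

/-- A walk of `k` hops leads from `r` to the node, and all nodes after `r` are correct. -/
inductive Near (E : Trace n) (G : SimpleGraph (Fin n)) (r : Fin n) : ℕ → Fin n → Prop
  | zero : Near E G r 0 r
  | succ {k : ℕ} {q p : Fin n} :
      Near E G r k q → G.Adj p q → E.Correct p → Near E G r (k + 1) p

/-- Either a path with a correct end leads through correct nodes only, except for its start `r`,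
or it contains another crashing node, which is nearer to the end. -/
theorem near_or_of_isPath {r p : Fin n} {π : List (Fin n)} (h : IsPath G r p π)
    (hp : E.Correct p) : (∃ j, j + 1 ≤ π.length ∧ E.Near G r j p) ∨
      ∃ x ∈ π, x ≠ r ∧ ¬ E.Correct x ∧ ∃ i, i + 1 < π.length ∧ E.Near G x i p := by
  induction h with
  | single => exact Or.inl ⟨0, by simp, .zero⟩
  | @snoc q p π hπ hpq hpπ ih =>
    rw [List.length_append, List.length_singleton]
    by_cases hq : E.Correct q
    · rcases ih hq with ⟨j, hj, hj'⟩ | ⟨x, hx, hxr, hxc, i, hi, hi'⟩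
      · exact Or.inl ⟨j + 1, by omega, hj'.succ hpq hp⟩
      · exact Or.inr ⟨x, by simp [hx], hxr, hxc, i + 1, by omega, hi'.succ hpq hp⟩
    · by_cases hqr : q = r
      · subst hqr
        exact Or.inl ⟨1, by have := hπ.length_pos; omega, Near.zero.succ hpq hp⟩
      -- As `q ≠ r`, the path has at least three nodes, which gives the strict inequality.
      · refine Or.inr ⟨q, ?_, hqr, hq, 1, ?_, Near.zero.succ hpq hp⟩
        · obtain ⟨ρ, rfl⟩ := hπ.exists_concat
          simp
        · cases hπ with
          | single => exact absurd rfl hqr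
          | snoc h1 _ _ =>
            have := h1.length_pos
            simp
            omega

namespace IsExecution

/-- A node that is `k` hops away from `r` eventually knows a path of `k` hops from `r` all whose
other nodes are correct. -/
theorem exists_eventually_mem_paths (h : E.IsExecution G T clock) (hT : ∀ p, 0 < T p)
    (hT0 : ∀ p, (clock p).reading 0 ≤ T p)
    (hadd : ∀ p q, G.Adj p q → E.IsADDChannel q p) {r p : Fin n} {k : ℕ}
    (hk : E.Near G r k p) (hp : E.Correct p) (hmin : ∀ j < k, ¬ E.Near G r j p) :
    ∃ π : List (Fin n), (∀ᶠ i in atTop, π ∈ (E.state i p).paths r) ∧ π.length = k + 1 ∧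
      ∀ x ∈ π, (∃ j ≤ k, E.Near G r j x) ∧
        (x ≠ r → E.Correct x ∧ ∃ j < k, E.Near G x j p) := by
  induction hk with
  | zero =>
    refine ⟨[r], Eventually.of_forall fun i => h.paths_mono r r (Nat.zero_le i) ?_, rfl, ?_⟩
    · simp [h.state_zero, initialState]
    · intro x hx
      obtain rfl := List.mem_singleton.1 hx
      exact ⟨⟨0, le_rfl, .zero⟩, fun h => absurd rfl h⟩
  | @succ k q p hk hpq _ ih =>
    have hpr : p ≠ r := by
      rintro rfl
      exact hmin 0 (by omega) .zero
    by_cases hqr : q = r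
    · subst hqr
      obtain rfl : k = 0 := by
        by_contra h0
        exact hmin 1 (by omega) (Near.zero.succ hpq hp)
      refine ⟨[q, p], Eventually.of_forall fun i => h.paths_mono p q (Nat.zero_le i) ?_,
        rfl, ?_⟩
      · simp [h.state_zero, initialState, hpr.symm, hpq]
      · intro x hx
        simp only [List.mem_cons, List.not_mem_nil, or_false] at hx
        rcases hx with rfl | rfl
        · exact ⟨⟨0, by omega, .zero⟩, fun h => absurd rfl h⟩
        · exact ⟨⟨1, by omega, Near.zero.succ hpq hp⟩, fun _ => ⟨hp, 0, by omega, .zero⟩⟩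
    · have hq : E.Correct q := by
        cases hk with
        | zero => exact absurd rfl hqr
        | succ _ _ hq => exact hq
      -- Path sets for neighbours never grow, so learning a longer path requires that `r` is not
      -- adjacent to `p`; minimality of the distance provides this.
      have hpr' : ¬ G.Adj p r := by
        intro hadj
        rcases Nat.eq_zero_or_pos k with rfl | h0
        · cases hk
          exact hqr rfl
        · exact hmin 1 (by omega) (Near.zero.succ hadj hp)
      obtain ⟨π, h1, h2, h3⟩ := ih hq fun j hj hj' => hmin (j + 1) (by omega) (hj'.succ hpq hp)
      have hpπ : p ∉ π := by
        intro hpπ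
        obtain ⟨⟨j, hj, hj'⟩, -⟩ := h3 p hpπ
        exact hmin j (by omega) hj'
      refine ⟨π ++ [p], ?_, by simp [h2], ?_⟩
      · obtain ⟨i, ⟨m, hm⟩, hi⟩ :=
          ((h.frequently_received hT hT0 (hadd p q hpq) hp hq).and_eventually
            (h.eventually_sent h1 p)).exists
        obtain ⟨-, -, -, -, h4⟩ := h.recv_of_not_adj hm hpr'
        filter_upwards [eventually_ge_atTop (i + 1)] with i' hi'
        refine h.paths_mono p r hi' ?_
        simp only [h4, Finset.mem_union, Finset.mem_image, Finset.mem_filter]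
        exact Or.inr ⟨π, ⟨hi q m hm, hpπ⟩, rfl⟩
      · intro x hx
        rcases List.mem_append.1 hx with hx | hx
        · obtain ⟨⟨j, hj, hj'⟩, h4⟩ := h3 x hx
          refine ⟨⟨j, by omega, hj'⟩, fun hxr => ⟨(h4 hxr).1, ?_⟩⟩
          obtain ⟨-, i, hi, hi'⟩ := h4 hxr
          exact ⟨i + 1, by omega, hi'.succ hpq hp⟩
        · obtain rfl := List.mem_singleton.1 hx
          exact ⟨⟨k + 1, le_rfl, hk.succ hpq hp⟩, fun _ => ⟨hp, 0, by omega, .zero⟩⟩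

/-- Eventually the local suspicions about the correct nodes of the component of `p`, and about the
crashed nodes next to it, are right. -/
theorem eventually_suspectLocal_iff (h : E.IsExecution G T clock) (hT : ∀ p, 0 < T p)
    (hT0 : ∀ p, (clock p).reading 0 ≤ T p)
    (hadd : ∀ p q, G.Adj p q → E.IsADDChannel q p) (k : ℕ) :
    ∀ᶠ i in atTop, ∀ p r, E.Correct p → E.Near G r k p →
      ((E.state i p).suspectLocal r = true ↔ ¬ E.Correct r) := by
  induction k using Nat.strong_induction_on with
  | _ k ih =>
    simp only [eventually_all]
    intro p r hp hk
    by_cases hmin : ∃ j < k, E.Near G r j p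
    · obtain ⟨j, hj, hj'⟩ := hmin
      filter_upwards [ih j hj] with i hi
      exact hi p r hp hj'
    push Not at hmin
    have hpath := h.exists_eventually_mem_paths hT hT0 hadd hk hp hmin
    cases hk with
    | zero =>
      filter_upwards with i
      simp [h.suspectLocal_self, hp]
    | @succ k q _ hk hpq _ =>
      by_cases hpr : G.Adj p r
      · by_cases hr : E.Correct r
        · filter_upwards [h.eventually_not_suspectLocal_of_correct hT hT0 (hadd p r hpr) hp hpr
            hr] with i hi
          simp [hi, hr]
        · filter_upwards [h.eventually_suspectLocal_of_not_correct hT hT0 hp hpr hr] with i hi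
          simp [hi, hr]
      have hqr : q ≠ r := by
        rintro rfl
        exact hpr hpq
      have hq : E.Correct q := by
        cases hk with
        | zero => exact absurd rfl hqr
        | succ _ _ hq => exact hq
      have hall : ∀ᶠ i in atTop, ∀ j ≤ k, ∀ p r, E.Correct p → E.Near G r j p →
          ((E.state i p).suspectLocal r = true ↔ ¬ E.Correct r) := by
        have := (eventually_all_finset (Finset.range (k + 1))).2 fun j hj =>
          ih j (Finset.mem_range.1 hj)
        filter_upwards [this] with i hi j hj
        exact hi j (Finset.mem_range.2 (by omega))
      obtain ⟨π, hπ1, hπ2, hπ3⟩ := hpath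
      obtain ⟨ρ, hρ1, hρ2, hρ3⟩ := h.exists_eventually_mem_paths hT hT0 hadd hk hq
        fun j hj hj' => hmin (j + 1) (by omega) (hj'.succ hpq hp)
      have hpρ : p ∉ ρ := by
        intro hpρ
        obtain ⟨⟨j, hj, hj'⟩, -⟩ := hρ3 p hpρ
        exact hmin j (by omega) hj'
      -- No short path appears valid, unless it has no crashed node except possibly `r`.
      have hshort : ∀ (i : ℕ) (p' : Fin n) (f : Fin n → Bool) (σ : List (Fin n)),
          (∀ j ≤ k, ∀ x, E.Near G x j p' → (f x = true ↔ ¬ E.Correct x)) →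
          E.Correct p' → σ ∈ (E.state i p').paths r → σ.length ≤ k + 1 →
          (∀ u ∈ σ, u ≠ r → f u = false) → ∃ j ≤ k, E.Near G r j p' := by
        intro i p' f σ hf hp' hσ hlen hval
        rcases near_or_of_isPath (h.isPath_of_mem_paths i hσ) hp' with
          ⟨j, hj, hj'⟩ | ⟨x, hx, hxr, hxc, j, hj, hj'⟩
        · exact ⟨j, by omega, hj'⟩
        · have h1 := (hf j (by omega) x hj').2 hxc
          rw [hval x hx hxr] at h1
          simp at h1
      -- Inside the receiving loop, entries may be old or new; near nodes are judged correctly in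
      -- both states, hence also in the mixed one.
      have hmid : ∀ {i : ℕ} {s' : NodeState n},
          (∀ j ≤ k, ∀ p r, E.Correct p → E.Near G r j p →
            ((E.state i p).suspectLocal r = true ↔ ¬ E.Correct r)) →
          (∀ j ≤ k, ∀ p r, E.Correct p → E.Near G r j p →
            ((E.state (i + 1) p).suspectLocal r = true ↔ ¬ E.Correct r)) →
          (∀ x, s'.suspectLocal x = (E.state i p).suspectLocal x ∨
            s'.suspectLocal x = (E.state (i + 1) p).suspectLocal x) →
          ∀ j ≤ k, ∀ x, E.Near G x j p → (s'.suspectLocal x = true ↔ ¬ E.Correct x) := by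
        intro i s' h1 h2 h3 j hj x hx
        rcases h3 x with h4 | h4
        · rw [h4, h1 j hj p x hp hx]
        · rw [h4, h2 j hj p x hp hx]
      -- Any late adoption is right, whoever the sender: `π` looks valid to `p`, so the sender must
      -- offer a path of at most `k` hops, and by `hshort` it is then within `k` hops of `r`.
      have hlate : ∀ᶠ i in atTop, ∀ q m, E.event i = Event.recv p q m →
          (((E.state (i + 1) p).suspectLocal r = true ↔ ¬ E.Correct r) ∨
            (E.state (i + 1) p).suspectLocal r = (E.state i p).suspectLocal r) := by
        filter_upwards [hall, (tendsto_add_atTop_nat 1).eventually hall,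
          h.eventually_sent hall p, h.eventually_sender_correct p, hπ1] with
          i h1 h2 h3 h4 h5 q m hm
        obtain ⟨s', h6, h7, h8, -⟩ := h.recv_of_not_adj hm hpr
        rw [h8]
        split
        case isFalse => exact Or.inr rfl
        case isTrue hlt =>
          left
          have h9 : hop s' r ≤ (k + 1 : ℕ) := by
            have hmem : π ∈ (s'.paths r).filter
                fun π => ∀ u ∈ π, u ≠ r → s'.suspectLocal u = false := by
              rw [Finset.mem_filter, h6]
              refine ⟨h5, fun u hu hur => ?_⟩
              obtain ⟨hu1, j, hj, hu2⟩ := (hπ3 u hu).2 hur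
              simpa [hu1] using hmid h1 h2 h7 j (by omega) u hu2
            refine (Finset.inf_le hmem).trans ?_
            simp [hops, hπ2]
          have h10 := hlt.trans_le h9
          rw [hopFromMsg, Finset.inf_lt_iff] at h10
          obtain ⟨σ, hσ, hσ'⟩ := h10
          rw [Finset.mem_filter] at hσ
          obtain ⟨hσ1, hσ2, hσ3⟩ := hσ
          have hlen : σ.length ≤ k + 1 := by
            simp only [hops, Nat.cast_lt] at hσ'
            omega
          obtain ⟨j, hj, hj'⟩ := hshort m q (E.state m q).suspectLocal σ
            (fun j hj x hx => h3 q m hm j hj q x (h4 q m hm) hx) (h4 q m hm) hσ1 hlen hσ3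
          exact h3 q m hm j hj q r (h4 q m hm) hj'
      -- For the neighbour `q` on a shortest walk, adoption really happens: `ρ` offers `k` hops,
      -- while a valid-looking path of at most `k` hops at `p` would contradict minimality.
      have hlate' : ∀ᶠ i in atTop, ∀ m, E.event i = Event.recv p q m →
          ((E.state (i + 1) p).suspectLocal r = true ↔ ¬ E.Correct r) := by
        filter_upwards [hall, (tendsto_add_atTop_nat 1).eventually hall,
          h.eventually_sent hall p, h.eventually_sent hρ1 p] with i h1 h2 h3 h4 m hm
        obtain ⟨s', h6, h7, h8, -⟩ := h.recv_of_not_adj hm hpr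
        rw [h8, if_pos]
        · exact h3 q m hm k le_rfl q r hq hk
        · have h9 : hopFromMsg p ((E.state m q).heartbeat q) r ≤ (k : ℕ) := by
            have hmem : ρ ∈ (((E.state m q).heartbeat q).paths r).filter fun π => p ∉ π ∧
                ∀ u ∈ π, u ≠ r → ((E.state m q).heartbeat q).suspects u = false := by
              rw [Finset.mem_filter]
              refine ⟨h4 q m hm, hpρ, fun u hu hur => ?_⟩
              obtain ⟨hu1, j, hj, hu2⟩ := (hρ3 u hu).2 hur
              have hu3 : ((E.state m q).heartbeat q).suspects u = true ↔ ¬ E.Correct u :=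
                h3 q m hm j hj.le q u hq hu2
              simpa [hu1] using hu3
            refine (Finset.inf_le hmem).trans ?_
            simp [hops, hρ2]
          refine h9.trans_lt ?_
          rw [hop, Finset.lt_inf_iff (by simp)]
          intro σ hσ
          rw [Finset.mem_filter, h6] at hσ
          by_contra hlt
          have hlen : σ.length ≤ k + 1 := by
            simp only [hops, Nat.cast_lt] at hlt
            omega
          obtain ⟨j, hj, hj'⟩ := hshort i p s'.suspectLocal σ (hmid h1 h2 h7) hp hσ.1 hlen hσ.2
          exact hmin j (by omega) hj'
      -- One late message from `q` makes the entry right, and `hlate` keeps it right.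
      obtain ⟨N, hN⟩ := eventually_atTop.1 hlate
      obtain ⟨i, ⟨m, hm⟩, hi, hiN⟩ :=
        ((h.frequently_received hT hT0 (hadd p q hpq) hp hq).and_eventually
          (hlate'.and (eventually_ge_atTop N))).exists
      filter_upwards [eventually_ge_atTop (i + 1)] with l hl
      induction l, hl using Nat.le_induction with
      | base => exact hi m hm
      | succ l hl ihl =>
        by_cases hrec : ∃ q m, E.event l = Event.recv p q m
        · obtain ⟨q', m', hl'⟩ := hrec
          rcases hN l (by omega) q' m' hl' with h1 | h1
          · exact h1
          · rwa [h1]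
        · push Not at hrec
          rwa [h.suspectLocal_succ_of_not_adj hrec hpr]

/-! ### The derived suspicions -/

theorem suspect_succ_or (h : E.IsExecution G T clock) (i : ℕ) (p : Fin n) :
    E.state (i + 1) p = E.state i p ∨
      (E.state (i + 1) p).suspect = (derive G p (E.state (i + 1) p)).suspect := by
  rcases h.step_cases i p with ⟨h1, -⟩ | ⟨q, -, -, -, h1⟩ | ⟨q, m, -, -, -, -, order, -, -, h1⟩
  · exact Or.inl h1
  · rw [h1]
    exact Or.inr rfl
  · rw [h1]
    exact Or.inr rfl

/-- Initially `suspect` is false even for nodes without a known path, so it agrees with its derived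
value only after a first derivation. Connectedness supplies a neighbour, whose messages or whose
crash force one. For `r = p`, where there may be no neighbour, the initial value already agrees. -/
theorem eventually_suspect_eq (h : E.IsExecution G T clock) (hG : G.Connected)
    (hT : ∀ p, 0 < T p) (hT0 : ∀ p, (clock p).reading 0 ≤ T p)
    (hadd : ∀ p q, G.Adj p q → E.IsADDChannel q p) {p : Fin n} (hp : E.Correct p) (r : Fin n) :
    ∀ᶠ i in atTop, (E.state i p).suspect r = (derive G p (E.state i p)).suspect r := by
  have hex : ∃ i, (E.state i p).suspect r = (derive G p (E.state i p)).suspect r := by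
    by_cases hpr : r = p
    · subst hpr
      refine ⟨0, ?_⟩
      simp [h.state_zero, initialState, derive]
    · by_contra! hcon
      have hconst : ∀ i, E.state i p = E.state 0 p := by
        intro i
        induction i with
        | zero => rfl
        | succ i ih =>
          rcases h.suspect_succ_or i p with h1 | h1
          · rw [h1, ih]
          · exact absurd (congrFun h1 r) (hcon (i + 1))
      obtain ⟨q, hpq⟩ : ∃ q, G.Adj p q := by
        obtain ⟨w⟩ := hG.preconnected p r
        cases w with
        | nil => exact absurd rfl hpr
        | cons hadj _ => exact ⟨_, hadj⟩
      by_cases hq : E.Correct q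
      · obtain ⟨i, m, hi⟩ := (h.frequently_received hT hT0 (hadd p q hpq) hp hq).exists
        rcases h.step_cases i p with ⟨-, h1, -⟩ | ⟨q', h1, -⟩ | ⟨q', m', -, -, -, -, _, -, -, h1⟩
        · exact h1 q m hi
        · simp [h1] at hi
        · refine hcon (i + 1) ?_
          rw [h1]
          rfl
      · obtain ⟨i, hi⟩ :=
          (h.eventually_suspectLocal_of_not_correct hT hT0 hp hpq hq).exists
        simp [hconst, h.state_zero, initialState] at hi
  obtain ⟨N, hN⟩ := hex
  filter_upwards [eventually_ge_atTop N] with i hi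
  induction i, hi using Nat.le_induction with
  | base => exact hN
  | succ i hi ih =>
    rcases h.suspect_succ_or i p with h1 | h1
    · rw [h1, ih]
    · rw [h1]

end IsExecution

/-! ### The eventual network -/

theorem connectedIn_networkGraph_iff {t : ℝ} (ht : E.crashedAt t = {p | ¬ E.Correct p})
    {p q : Fin n} :
    ConnectedIn (E.networkGraph G t) p q ↔ E.Correct q ∧ ∃ k, E.Near G q k p := by
  have hverts : ∀ x, x ∈ (E.networkGraph G t).verts ↔ E.Correct x := by
    intro x
    simp [networkGraph, ht]
  have hadj : ∀ x y, (E.networkGraph G t).Adj x y ↔ E.Correct x ∧ E.Correct y ∧ G.Adj x y := by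
    intro x y
    simp [networkGraph, ht]
  constructor
  · rintro ⟨hp', hq', ⟨w⟩⟩
    refine ⟨(hverts q).1 hq', ?_⟩
    have key : ∀ (x y : (E.networkGraph G t).verts), (E.networkGraph G t).coe.Walk x y →
        ∃ k, E.Near G y.1 k x.1 := by
      intro x y w
      induction w with
      | nil => exact ⟨0, .zero⟩
      | cons h1 _ ih =>
        obtain ⟨k, hk⟩ := ih
        obtain ⟨h2, -, h3⟩ := (hadj _ _).1 h1
        exact ⟨k + 1, hk.succ h3 h2⟩
    exact key _ _ w
  · rintro ⟨hq, k, hk⟩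
    induction hk with
    | zero => exact ⟨(hverts q).2 hq, (hverts q).2 hq, .refl _⟩
    | succ _ h1 h2 ih =>
      obtain ⟨h3, h4, h5⟩ := ih
      refine ⟨(hverts _).2 h2, h4, SimpleGraph.Reachable.trans ?_ h5⟩
      exact SimpleGraph.Adj.reachable ((hadj _ _).2 ⟨h2, (hverts _).1 h3, h1⟩)

theorem eventually_crashedAt_eq (E : Trace n) :
    ∀ᶠ t in atTop, E.crashedAt t = {p | ¬ E.Correct p} := by
  have h1 : ∀ᶠ t in atTop, ∀ p, ¬ E.Correct p → p ∈ E.crashedAt t := by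
    simp only [eventually_all]
    intro p hp
    simp only [Correct, not_forall, not_not] at hp
    obtain ⟨j, hj⟩ := hp
    filter_upwards [eventually_ge_atTop (E.time (j + 1))] with t ht
    exact ⟨j, hj, ht⟩
  filter_upwards [h1] with t ht
  ext p
  exact ⟨fun ⟨i, hi, _⟩ hp => hp i hi, ht p⟩

namespace IsExecution

theorem eventually_suspect_iff (h : E.IsExecution G T clock) (hG : G.Connected)
    (hT : ∀ p, 0 < T p) (hT0 : ∀ p, (clock p).reading 0 ≤ T p)
    (hadd : ∀ p q, G.Adj p q → E.IsADDChannel q p) :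
    ∀ᶠ i in atTop, ∀ p q, E.Correct p →
      ((E.state i p).suspect q = true ↔ ¬ (E.Correct q ∧ ∃ k, E.Near G q k p)) := by
  simp only [eventually_all]
  intro p q hp
  have hloc : ∀ᶠ i in atTop, ∀ x, (∃ k, E.Near G x k p) →
      ((E.state i p).suspectLocal x = true ↔ ¬ E.Correct x) := by
    simp only [eventually_all]
    rintro x ⟨k, hk⟩
    filter_upwards [h.eventually_suspectLocal_iff hT hT0 hadd k] with i hi
    exact hi p x hp hk
  have hder := h.eventually_suspect_eq hG hT hT0 hadd hp q
  classical
  by_cases hnear : ∃ k, E.Near G q k p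
  · obtain ⟨π, hπ1, -, hπ3⟩ := h.exists_eventually_mem_paths hT hT0 hadd
      (Nat.find_spec hnear) hp fun j hj => Nat.find_min hnear hj
    filter_upwards [hloc, hder, hπ1] with i h1 h2 h3
    rw [h2]
    simp only [derive, hnear, and_true]
    rw [if_neg, h1 q hnear]
    rintro ⟨-, h4⟩
    obtain ⟨u, hu, hur, hus⟩ := h4 π h3
    obtain ⟨hu1, j, -, hu2⟩ := (hπ3 u hu).2 hur
    exact (h1 u ⟨j, hu2⟩).1 hus hu1
  · filter_upwards [hloc, hder] with i h1 h2
    rw [h2]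
    simp only [derive, hnear, and_false, not_false_eq_true, iff_true]
    rw [if_pos]
    -- A neighbour is near even if it crashes, so an unreachable `q` is a non-neighbour and the path
    -- rule applies to it.
    refine ⟨fun hadj => hnear ⟨1, Near.zero.succ hadj hp⟩, fun π hπ => ?_⟩
    rcases near_or_of_isPath (h.isPath_of_mem_paths i hπ) hp with
      ⟨j, -, hj⟩ | ⟨x, hx, hxq, hxc, j, -, hj⟩
    · exact absurd ⟨j, hj⟩ hnear
    · exact ⟨x, hx, hxq, (h1 x ⟨j, hj⟩).2 hxc⟩

theorem eventuallyPerfect (h : E.IsExecution G T clock) (hG : G.Connected)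
    (hT : ∀ p, 0 < T p) (hT0 : ∀ p, (clock p).reading 0 ≤ T p)
    (hadd : ∀ p q, G.Adj p q → E.IsADDChannel q p) : E.EventuallyPerfect G := by
  obtain ⟨N, hN⟩ := eventually_atTop.1 (h.eventually_suspect_iff hG hT hT0 hadd)
  obtain ⟨t₁, ht₁⟩ := eventually_atTop.1 E.eventually_crashedAt_eq
  refine ⟨max (E.time N) t₁, fun t ht i hi p hp => ?_⟩
  -- Several states can be in force at one instant; since `t` lies strictly after `time N`, all of
  -- them have index at least `N`.
  have hiN : N ≤ i := by
    have := h.time_mono.reflect_lt (((le_max_left _ _).trans_lt ht).trans_le hi.2)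
    omega
  have key := fun q => hN i hiN p q hp
  have hcon := fun q => connectedIn_networkGraph_iff (G := G) (p := p) (q := q)
    (ht₁ t ((le_max_right _ _).trans ht.le))
  refine ⟨fun q hq => (key q).2 (by rwa [← hcon q]), fun q hq hs => ?_⟩
  exact (key q).1 hs ((hcon q).1 hq)

end IsExecution
end Trace

theorem mainTheorem1 :
    ∃ C : ℕ, ∀ (n : ℕ) (G : SimpleGraph (Fin n)), G.Connected →
      ∀ (T : Fin n → ℕ) (clock : Fin n → LocalClock),
        (∀ p, 0 < T p) → (∀ p, (clock p).reading 0 ≤ T p) →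
      ∀ E : Trace n, E.IsExecution G T clock → (∀ p q, G.Adj p q → E.IsADDChannel q p) →
        E.EventuallyPerfect G ∧
        ∀ m p, E.event m = Event.heartbeat p →
          ((E.state m p).heartbeat p).bits ≤ C * (n + 1).factorial := by
  refine ⟨10, fun n G hG T clock hT hT0 E h hadd => ⟨?_, fun m p _ => ?_⟩⟩
  · exact h.eventuallyPerfect hG hT hT0 hadd
  · exact h.bits_heartbeat_le m p
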